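/- Let $p$ be a nonconstant real polynomial, let $b\neq 0$ be a real number, and let $\varphi(z)=e^{bz}p(z)$. Put $$Q=\left(\frac{\varphi'}{\varphi}\right)'=\frac{\varphi\varphi''-(\varphi')^2}{\varphi^2},\qquad Q_1=\left(\frac{\varphi''}{\varphi'}\right)'=\frac{\varphi'\varphi'''-(\varphi'')^2}{(\varphi')^2},$$ viewed as meromorphic functions. For a meromorphic function $f$ with finitely many real zeros, let $Z_{\mathbb R}(f)$ be the number of its real zeros, counted with multiplicity. Let $E(\varphi')$ be the number of extra zeros of $\varphi'$, defined as follows (all zeros are counted with multiplicity). If $a<a'$ are consecutive distinct real zeros of $\varphi$, then $\varphi'$ has an odd number $2r+1$ of zeros in $(a,a')$, and this interval contributes $2r$ extra zeros. Every zero of $\varphi'$ greater than the largest real zero of $\varphi$ or less than the smallest real zero of $\varphi$ is extra; if $\varphi$ has no real zeros, every real zero of $\varphi'$ is extra. The function $\varphi$ has property A if for each real zero $\alpha$ of $\varphi$ the following holds. Let $\beta_1$ be the largest zero of $\varphi'$ in $(-\infty,\alpha)$, with $\beta_1=-\infty$ if there is none, and let $\beta_2$ be the smallest zero of $\varphi'$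 in $(\alpha,+\infty)$, with $\beta_2=+\infty$ if there is none; then $Q$ has no zeros in at least one of the intervals $(\beta_1,\alpha)$ and $(\alpha,\beta_2)$. In particular, $\varphi$ has property A if it has no real zeros. If $\varphi$ has property A, then $Q$ and $Q_1$ have only finitely many real zeros and $$2\left[\frac{E(\varphi')}{2}\right]\;\le\; Z_{\mathbb R}(Q)\;\le\; 2\left[\frac{E(\varphi')}{2}\right]+Z_{\mathbb R}(Q_1),$$ where $[x]$ is the largest integer not exceeding $x$. -/

import Mathlib

open Set Polynomial

noncomputable section

/-- The real zeros of a function meromorphic on the line. The order does not see the value that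
Lean assigns to the function at a pole. -/
def realZeros (f : ℝ → ℝ) : Set ℝ := {x | 0 < meromorphicOrderAt f x}

/-- The multiplicity of `x` as a zero of `f`; it is `0` if `x` is not a zero (for instance a pole). -/
def zeroMult (f : ℝ → ℝ) (x : ℝ) : ℕ := (meromorphicOrderAt f x).untop₀.toNat

/-- `Z_X(f)`: the number of zeros of `f` in `X`, counting multiplicities. -/
def numZeros (X : Set ℝ) (f : ℝ → ℝ) : ℕ := ∑ᶠ x ∈ X, zeroMult f x

/-- `Q[φ] = (φ'/φ)'`. -/
def assocQ (φ : ℝ → ℝ) : ℝ → ℝ := deriv (logDeriv φ)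

/-- `a < b` are consecutive real zeros of `φ`. -/
def ConsecutiveZeros (φ : ℝ → ℝ) (a b : ℝ) : Prop :=
  a < b ∧ φ a = 0 ∧ φ b = 0 ∧ ∀ x ∈ Ioo a b, φ x ≠ 0

/-- The points of the line lying to the right of all real zeros of `φ` or to the left of all of
them. If `φ` has a largest and a smallest zero these are the two unbounded intervals they bound;
if `φ` has no real zero this is the whole line. -/
def outerSet (φ : ℝ → ℝ) : Set ℝ :=
  {x | (∀ a, φ a = 0 → a < x) ∨ (∀ a, φ a = 0 → x < a)}

/-- `E(φ')`: the number of extra zeros of `φ'`, counting multiplicities. If `φ'` has `2r + 1` zeros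
between two consecutive zeros of `φ`, then `2r` of them are extra; all zeros of `φ'` in
`outerSet φ` are extra. -/
def numExtraZeros (φ : ℝ → ℝ) : ℕ :=
  (∑ᶠ ab ∈ {ab : ℝ × ℝ | ConsecutiveZeros φ ab.1 ab.2},
      (numZeros (Ioo ab.1 ab.2) (deriv φ) - 1))
    + numZeros (outerSet φ) (deriv φ)

/-- The interval `(β₁, α)`, where `β₁` is the zero of `φ'` nearest to `α` on its left, and
`β₁ = -∞` if there is none. -/
def leftInterval (φ : ℝ → ℝ) (α : ℝ) : Set ℝ :=
  {x | x < α ∧ ∀ y ∈ Ico x α, deriv φ y ≠ 0}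

/-- The interval `(α, β₂)`, where `β₂` is the zero of `φ'` nearest to `α` on its right, and
`β₂ = +∞` if there is none. -/
def rightInterval (φ : ℝ → ℝ) (α : ℝ) : Set ℝ :=
  {x | α < x ∧ ∀ y ∈ Ioc α x, deriv φ y ≠ 0}

/-- Property A of `φ` at its real zero `α`. -/
def PropertyAAt (φ : ℝ → ℝ) (α : ℝ) : Prop :=
  Disjoint (leftInterval φ α) (realZeros (assocQ φ)) ∨
    Disjoint (rightInterval φ α) (realZeros (assocQ φ))

/-- Property A. -/
def PropertyA (φ : ℝ → ℝ) : Prop := ∀ α, φ α = 0 → PropertyAAt φ α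

theorem leftInterval_eq_Ioo {φ : ℝ → ℝ} {α β : ℝ} (hβ : β < α) (h0 : deriv φ β = 0)
    (h : ∀ y ∈ Ioo β α, deriv φ y ≠ 0) : leftInterval φ α = Ioo β α := by
  ext x
  constructor
  · rintro ⟨h1, h2⟩
    refine ⟨?_, h1⟩
    by_contra hx
    exact h2 β ⟨not_lt.mp hx, hβ⟩ h0
  · rintro ⟨h1, h2⟩
    exact ⟨h2, fun y hy => h y ⟨lt_of_lt_of_le h1 hy.1, hy.2⟩⟩

theorem leftInterval_eq_Iio {φ : ℝ → ℝ} {α : ℝ} (h : ∀ y < α, deriv φ y ≠ 0) :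
    leftInterval φ α = Iio α := by
  ext x
  exact ⟨fun hx => hx.1, fun hx => ⟨hx, fun y hy => h y hy.2⟩⟩

theorem rightInterval_eq_Ioo {φ : ℝ → ℝ} {α β : ℝ} (hβ : α < β) (h0 : deriv φ β = 0)
    (h : ∀ y ∈ Ioo α β, deriv φ y ≠ 0) : rightInterval φ α = Ioo α β := by
  ext x
  constructor
  · rintro ⟨h1, h2⟩
    refine ⟨h1, ?_⟩
    by_contra hx
    exact h2 β ⟨hβ, not_lt.mp hx⟩ h0
  · rintro ⟨h1, h2⟩
    exact ⟨h1, fun y hy => h y ⟨hy.1, lt_of_le_of_lt hy.2 h2⟩⟩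

theorem rightInterval_eq_Ioi {φ : ℝ → ℝ} {α : ℝ} (h : ∀ y, α < y → deriv φ y ≠ 0) :
    rightInterval φ α = Ioi α := by
  ext x
  exact ⟨fun hx => hx.1, fun hx => ⟨hx, fun y hy => h y hy.1⟩⟩

end

/-! Write φ' = e^{bx} p₁ with p₁ = p' + bp, so that Q = L/p² and Q₁ = L₁/p₁², where L and L₁ are
`laguerre p` and `laguerre p₁`. Let N be the number of distinct real zeros of φ, and S the number,
with multiplicity, of real zeros of φ' at which φ ≠ 0. Then E(φ') = S - N + 1 if N > 0, and E(φ') =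
S if N = 0. Since S + N is even, 2[E/2] = S - N in both cases. Z(Q) and Z(Q₁) are even too, because
L and L₁ have even degree and negative leading coefficient and vanish to even order at the zeros of
p and p₁ respectively. Hence it is enough to prove both inequalities up to an error of one.

Lower bound (`sum_extraRoots_le`): Rolle applied to φ'/φ, whose derivative is Q, puts a zero of Q
between two extra zeros of φ' not separated by a zero of φ.

Upper bound (`sum_curvMult_add_card_le`): φ²Q/φ' = φφ''/φ' - φ' has derivative φQ₁, so Rolle puts a
zero of φQ₁ between two zeros of Q where φ' does not vanish. The zeros of φ spoil this, and property
A repairs it. The component of a zero a of φ is the interval around a cut out by the extra zeros of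
φ'. There the zeros of Q lie on one side of a, where L is negative near both ends. Their number is
therefore even, and Rolle plus parity bounds it by the number of zeros of Q₁ in the component
(`sum_curvMult_critComponent_le`). Outside the components, the zeros of Q and of φ are interleaved
with the zeros of Q₁ and the extra zeros of φ' (`sum_curvMult_outside_add_card_le`). -/

open Filter Topology

/-! ### Algebraic identities and multiplicities -/

/-- The polynomial `p' + b p`, so that `(exp (b x) p)' = exp (b x) (p' + b p)`. -/
noncomputable def tiltDeriv (b : ℝ) (p : ℝ[X]) : ℝ[X] := derivative p + C b * p

/-- The polynomial `p p'' - p'²`, so that `(p' / p)' = (p p'' - p'²) / p²`. -/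
noncomputable def laguerre (p : ℝ[X]) : ℝ[X] := p * derivative (derivative p) - derivative p ^ 2

/-- φ'/φ = p'/p + b, and the constant b disappears on differentiation. -/
theorem laguerre_eq_wronskian (b : ℝ) (p : ℝ[X]) :
    laguerre p = p * derivative (tiltDeriv b p) - derivative p * tiltDeriv b p := by
  simp only [laguerre, tiltDeriv, derivative_add, derivative_mul, derivative_C]
  ring

/-- The identity (φ²Q/φ')' = φQ₁ with denominators cleared: φ²Q/φ' = φ · (φ''/φ') - φ', and on
differentiating, the two terms φ'' cancel. -/
theorem derivative_laguerre_mul_sub (b : ℝ) (p : ℝ[X]) :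
    derivative (laguerre p) * tiltDeriv b p - laguerre p * derivative (tiltDeriv b p)
      + C b * laguerre p * tiltDeriv b p = p * laguerre (tiltDeriv b p) := by
  simp only [laguerre, tiltDeriv, derivative_add, derivative_sub, derivative_mul, derivative_C,
    derivative_pow, map_natCast]
  simp
  ring

/-- Each factor x - a adds -1/(x - a)² to (p'/p)'. The last factor is negative at a when q(a) ≠ 0,
which gives both the multiplicity and the sign of L near a zero of p. -/
theorem laguerre_X_sub_C_pow_mul (a : ℝ) (q : ℝ[X]) (k : ℕ) :
    laguerre ((X - C a) ^ (k + 1) * q) = (X - C a) ^ (2 * k) *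
      ((X - C a) ^ 2 * laguerre q - C ((k : ℝ) + 1) * q ^ 2) := by
  induction k with
  | zero =>
    simp only [laguerre, derivative_mul, derivative_add]
    simp
    ring
  | succ k ih =>
    have key : ∀ s : ℝ[X], laguerre ((X - C a) * s) = (X - C a) ^ 2 * laguerre s - s ^ 2 := by
      intro s
      simp only [laguerre, derivative_mul, derivative_add]
      simp
      ring
    rw [show (X - C a) ^ (k + 1 + 1) * q = (X - C a) * ((X - C a) ^ (k + 1) * q) by ring,
      key, ih]
    simp only [map_add, map_natCast, Nat.cast_add, map_one, Nat.cast_one]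
    ring

theorem rootMultiplicity_X_sub_C_pow_mul {a : ℝ} {q : ℝ[X]} (k : ℕ) (hq : q.eval a ≠ 0) :
    ((X - C a) ^ k * q).rootMultiplicity a = k := by
  have hq0 : q ≠ 0 := by rintro rfl; simp at hq
  rw [rootMultiplicity_mul (mul_ne_zero (pow_ne_zero _ (X_sub_C_ne_zero a)) hq0),
    rootMultiplicity_X_sub_C_pow, rootMultiplicity_eq_zero hq, add_zero]

theorem exists_eq_X_sub_C_pow_mul {p : ℝ[X]} (hp : p ≠ 0) {a : ℝ} (ha : p.eval a = 0) :
    ∃ (k : ℕ) (q : ℝ[X]), p = (X - C a) ^ (k + 1) * q ∧ q.eval a ≠ 0 ∧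
      p.rootMultiplicity a = k + 1 := by
  obtain ⟨q, h1, h2⟩ := exists_eq_pow_rootMultiplicity_mul_and_not_dvd p hp a
  have hpos : 0 < p.rootMultiplicity a := (rootMultiplicity_pos hp).2 ha
  obtain ⟨k, hk⟩ := Nat.exists_eq_succ_of_ne_zero hpos.ne'
  refine ⟨k, q, ?_, fun h => h2 (dvd_iff_isRoot.2 h), hk⟩
  rw [hk] at h1
  exact h1

theorem rootMultiplicity_laguerre_of_root {p : ℝ[X]} (hp : p ≠ 0) {a : ℝ} (ha : p.eval a = 0) :
    (laguerre p).rootMultiplicity a + 2 = 2 * p.rootMultiplicity a := by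
  obtain ⟨k, q, h, hq, hk⟩ := exists_eq_X_sub_C_pow_mul hp ha
  have h1 : (laguerre p).rootMultiplicity a = 2 * k := by
    rw [h, laguerre_X_sub_C_pow_mul]
    apply rootMultiplicity_X_sub_C_pow_mul
    have : (k : ℝ) + 1 ≠ 0 := by positivity
    simp [hq, this]
  omega

theorem rootMultiplicity_tiltDeriv_of_root (b : ℝ) {p : ℝ[X]} (hp : p ≠ 0) {a : ℝ}
    (ha : p.eval a = 0) :
    (tiltDeriv b p).rootMultiplicity a + 1 = p.rootMultiplicity a := by
  obtain ⟨k, q, h, hq, hk⟩ := exists_eq_X_sub_C_pow_mul hp ha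
  have h1 : (tiltDeriv b p).rootMultiplicity a = k := by
    have : tiltDeriv b p = (X - C a) ^ k *
        (C ((k : ℝ) + 1) * q + (X - C a) * tiltDeriv b q) := by
      rw [h, tiltDeriv, tiltDeriv, derivative_mul, derivative_X_sub_C_pow]
      simp only [Nat.cast_add, Nat.cast_one, map_add, map_natCast, map_one, Nat.add_sub_cancel]
      ring
    rw [this]
    apply rootMultiplicity_X_sub_C_pow_mul
    have : (k : ℝ) + 1 ≠ 0 := by positivity
    simp [hq, this]
  omega

theorem rootMultiplicity_le_laguerre_add_one {b : ℝ} {p : ℝ[X]} (h0 : laguerre p ≠ 0) (a : ℝ) :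
    (tiltDeriv b p).rootMultiplicity a ≤ (laguerre p).rootMultiplicity a + 1 := by
  have h1 : (tiltDeriv b p).rootMultiplicity a - 1 ≤ (laguerre p).rootMultiplicity a := by
    rw [le_rootMultiplicity_iff h0, laguerre_eq_wronskian b]
    apply dvd_sub
    · exact (pow_sub_one_dvd_derivative_of_pow_dvd (pow_rootMultiplicity_dvd _ a)).mul_left _
    · exact ((pow_dvd_pow _ (Nat.sub_le _ _)).trans (pow_rootMultiplicity_dvd _ a)).mul_left _
  omega

theorem rootMultiplicity_laguerre_of_tiltDeriv_root {b : ℝ} {p : ℝ[X]} (h1 : tiltDeriv b p ≠ 0)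
    {a : ℝ} (hp : p.eval a ≠ 0) (ha : (tiltDeriv b p).eval a = 0) :
    (laguerre p).rootMultiplicity a + 1 = (tiltDeriv b p).rootMultiplicity a := by
  obtain ⟨k, q, h, hq, hk⟩ := exists_eq_X_sub_C_pow_mul h1 ha
  have h1 : (laguerre p).rootMultiplicity a = k := by
    have : laguerre p = (X - C a) ^ k *
        (C ((k : ℝ) + 1) * p * q + (X - C a) * (p * derivative q - derivative p * q)) := by
      rw [laguerre_eq_wronskian b, h, derivative_mul, derivative_X_sub_C_pow]
      simp only [Nat.cast_add, Nat.cast_one, map_add, map_natCast, map_one, Nat.add_sub_cancel]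
      ring
    rw [this]
    apply rootMultiplicity_X_sub_C_pow_mul
    have : (k : ℝ) + 1 ≠ 0 := by positivity
    simp [hq, this, hp]
  omega

/-- By `derivative_laguerre_mul_sub`, a zero of L of order m is a zero of p L₁ of order at least m -
1, and p contributes nothing. -/
theorem rootMultiplicity_laguerre_le_add_one {b : ℝ} {p : ℝ[X]}
    (h1 : laguerre (tiltDeriv b p) ≠ 0) {a : ℝ} (hp : p.eval a ≠ 0) :
    (laguerre p).rootMultiplicity a ≤ (laguerre (tiltDeriv b p)).rootMultiplicity a + 1 := by
  have hp0 : p ≠ 0 := by rintro rfl; simp at hp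
  have : (laguerre p).rootMultiplicity a - 1 ≤
      (p * laguerre (tiltDeriv b p)).rootMultiplicity a := by
    have hd := pow_sub_one_dvd_derivative_of_pow_dvd (pow_rootMultiplicity_dvd (laguerre p) a)
    have hd' := (pow_dvd_pow _ (Nat.sub_le _ 1)).trans (pow_rootMultiplicity_dvd (laguerre p) a)
    rw [le_rootMultiplicity_iff (mul_ne_zero hp0 h1), ← derivative_laguerre_mul_sub]
    exact dvd_add (dvd_sub (hd.mul_right _) (hd'.mul_right _)) ((hd'.mul_left _).mul_right _)
  rw [rootMultiplicity_mul (mul_ne_zero hp0 h1), rootMultiplicity_eq_zero hp] at this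
  omega

/-! ### Negativity of L near the zeros of p and at infinity -/

theorem eventually_laguerre_neg {p : ℝ[X]} (hp : p ≠ 0) {a : ℝ} (ha : p.eval a = 0) :
    ∀ᶠ x in 𝓝[≠] a, (laguerre p).eval x < 0 := by
  obtain ⟨k, q, h, hq, -⟩ := exists_eq_X_sub_C_pow_mul hp ha
  set R := (X - C a) ^ 2 * laguerre q - C ((k : ℝ) + 1) * q ^ 2 with hR
  have hRa : R.eval a < 0 := by
    have : 0 < ((k : ℝ) + 1) * q.eval a ^ 2 := by positivity
    simpa [hR] using this
  have h1 : ∀ᶠ x in 𝓝 a, R.eval x < 0 := R.continuous.continuousAt.eventually_lt_const hRa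
  filter_upwards [h1.filter_mono nhdsWithin_le_nhds, self_mem_nhdsWithin] with x hx hxa
  have hx0 : x - a ≠ 0 := sub_ne_zero.2 hxa
  rw [h, laguerre_X_sub_C_pow_mul, eval_mul]
  refine mul_neg_of_pos_of_neg ?_ hx
  rw [eval_pow, pow_mul]
  have : eval x (X - C a) = x - a := by simp
  rw [this]
  positivity

/-- With d = n + 1 the degree of p, the top coefficient comes from d(d - 1) - d² = -d. -/
theorem laguerre_coeff {p : ℝ[X]} {n : ℕ} (hn : p.natDegree = n + 1) :
    (laguerre p).natDegree ≤ 2 * n ∧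
      (laguerre p).coeff (2 * n) = -((n : ℝ) + 1) * p.leadingCoeff ^ 2 := by
  have hd : (derivative p).natDegree ≤ n := by
    have := natDegree_derivative_le p; omega
  have hc : (derivative p).coeff n = p.leadingCoeff * (n + 1) := by
    rw [coeff_derivative, leadingCoeff, hn]
  have hsq : (derivative p ^ 2).coeff (2 * n) = (p.leadingCoeff * (n + 1)) ^ 2 := by
    rw [sq, two_mul, coeff_mul_add_eq_of_natDegree_le hd hd, hc, sq]
  have hsqd : (derivative p ^ 2).natDegree ≤ 2 * n := natDegree_pow_le_of_le 2 hd
  rcases n with _ | m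
  · have h0 : derivative (derivative p) = 0 := derivative_of_natDegree_zero (by omega)
    rw [laguerre, h0, mul_zero, zero_sub, natDegree_neg, coeff_neg, hsq]
    refine ⟨hsqd, ?_⟩
    push_cast; ring
  · have hdd : (derivative (derivative p)).natDegree ≤ m := by
      have := natDegree_derivative_le (derivative p); omega
    have hcc : (derivative (derivative p)).coeff m = p.leadingCoeff * (m + 2) * (m + 1) := by
      rw [coeff_derivative, hc]; push_cast; ring
    constructor
    · exact (natDegree_sub_le_of_le
        ((natDegree_mul_le_of_le hn.le hdd).trans (by omega : _ ≤ 2 * (m + 1)))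
        hsqd).trans (max_self _).le
    · rw [laguerre, coeff_sub, hsq, show 2 * (m + 1) = (m + 1 + 1) + m by ring,
        coeff_mul_add_eq_of_natDegree_le hn.le hdd, hcc, ← hn, coeff_natDegree]
      push_cast; ring

theorem natDegree_leadingCoeff_laguerre {p : ℝ[X]} (hp : 0 < p.natDegree) :
    laguerre p ≠ 0 ∧ Even (laguerre p).natDegree ∧ (laguerre p).leadingCoeff < 0 := by
  obtain ⟨n, hn⟩ := Nat.exists_eq_succ_of_ne_zero hp.ne'
  obtain ⟨h1, h2⟩ := laguerre_coeff hn
  have hlc : p.leadingCoeff ≠ 0 := by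
    rw [Ne, leadingCoeff_eq_zero]; rintro rfl; simp at hp
  have hneg : (laguerre p).coeff (2 * n) < 0 := by
    rw [h2]
    have : 0 < ((n : ℝ) + 1) * p.leadingCoeff ^ 2 := by positivity
    linarith
  have hdeg : (laguerre p).natDegree = 2 * n := natDegree_eq_of_le_of_coeff_ne_zero h1 hneg.ne
  refine ⟨fun h => by simp [h] at hneg, ⟨n, by omega⟩, ?_⟩
  rw [leadingCoeff, hdeg]; exact hneg

theorem natDegree_leadingCoeff_tiltDeriv {b : ℝ} (hb : b ≠ 0) (p : ℝ[X]) :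
    (tiltDeriv b p).natDegree = p.natDegree ∧
      (tiltDeriv b p).leadingCoeff = b * p.leadingCoeff := by
  rcases eq_or_ne p 0 with rfl | hp
  · simp [tiltDeriv]
  have hlt : (derivative p).degree < (C b * p).degree := by
    rw [degree_C_mul hb]; exact degree_derivative_lt hp
  constructor
  · rw [tiltDeriv, natDegree_add_eq_right_of_degree_lt hlt, natDegree_C_mul hb]
  · rw [tiltDeriv, leadingCoeff_add_of_degree_lt hlt, leadingCoeff_mul, leadingCoeff_C]

theorem eventually_neg_of_even_natDegree {F : ℝ[X]} (hd : Even F.natDegree)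
    (hl : F.leadingCoeff < 0) :
    (∀ᶠ x in atTop, F.eval x < 0) ∧ ∀ᶠ x in atBot, F.eval x < 0 := by
  have key : ∀ x : ℝ, x ≠ 0 → F.leadingCoeff * x ^ F.natDegree < 0 := fun x hx =>
    mul_neg_of_neg_of_pos hl (hd.pow_pos hx)
  have h1 := F.isEquivalent_atTop_lead.symm
  have h2 := F.isEquivalent_atBot_lead.symm
  constructor
  · obtain ⟨u, hu, hF⟩ := h1.symm.exists_eq_mul
    filter_upwards [hF, eventually_gt_atTop 0, hu.eventually_const_lt (zero_lt_one)] with x hx h0 hux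
    rw [hx]
    exact mul_neg_of_pos_of_neg hux (key x h0.ne')
  · obtain ⟨u, hu, hF⟩ := h2.symm.exists_eq_mul
    filter_upwards [hF, eventually_lt_atBot 0, hu.eventually_const_lt (zero_lt_one)] with x hx h0 hux
    rw [hx]
    exact mul_neg_of_pos_of_neg hux (key x h0.ne)

/-! ### Parity of the number of zeros -/

/-- Induction on the degree, splitting off all factors X - r for one root r in the interval; each
changes sign between u and v. Without roots this is the intermediate value theorem. -/
theorem sign_eval_mul_eval (U : Finset ℝ) {F : ℝ[X]} (hU : ∀ x, F.eval x = 0 → x ∈ U) {u v : ℝ}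
    (huv : u < v) (hu : F.eval u ≠ 0) (hv : F.eval v ≠ 0) :
    0 < (-1 : ℝ) ^ (∑ x ∈ U with u < x ∧ x < v, F.rootMultiplicity x) *
      (F.eval u * F.eval v) := by
  induction hn : F.natDegree using Nat.strong_induction_on generalizing F with
  | _ n ih =>
  have hF : F ≠ 0 := by rintro rfl; simp at hu
  by_cases hr : ∃ r ∈ Ioo u v, F.eval r = 0
  · obtain ⟨r, hrI, hr⟩ := hr
    obtain ⟨k, q, h, hq, hk⟩ := exists_eq_X_sub_C_pow_mul hF hr
    have hq0 : q ≠ 0 := by rintro rfl; simp at hq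
    have hqU : ∀ x, q.eval x = 0 → x ∈ U := fun x hx => hU x (by rw [h, eval_mul, hx, mul_zero])
    have hev : ∀ x, F.eval x = (x - r) ^ (k + 1) * q.eval x := fun x => by rw [h]; simp
    have hqu : q.eval u ≠ 0 := fun h0 => hu (by rw [hev, h0, mul_zero])
    have hqv : q.eval v ≠ 0 := fun h0 => hv (by rw [hev, h0, mul_zero])
    have hdeg : q.natDegree < n := by
      rw [← hn, h, natDegree_mul (pow_ne_zero _ (X_sub_C_ne_zero r)) hq0, natDegree_pow,
        natDegree_X_sub_C]
      omega
    have hmult : ∀ x, F.rootMultiplicity x = (if x = r then k + 1 else 0) +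
        q.rootMultiplicity x := by
      intro x
      split_ifs with hx
      · rw [hx, hk, rootMultiplicity_eq_zero hq, add_zero]
      · rw [h, rootMultiplicity_mul (mul_ne_zero (pow_ne_zero _ (X_sub_C_ne_zero r)) hq0)]
        congr 1
        apply rootMultiplicity_eq_zero
        simp [sub_eq_zero, hx]
    have hsum : ∑ x ∈ U with u < x ∧ x < v, F.rootMultiplicity x =
        (k + 1) + ∑ x ∈ U with u < x ∧ x < v, q.rootMultiplicity x := by
      rw [Finset.sum_congr rfl fun x _ => hmult x, Finset.sum_add_distrib, Finset.sum_ite_eq',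
        if_pos]
      exact Finset.mem_filter.2 ⟨hU r hr, hrI⟩
    have := ih _ hdeg hqU hqu hqv rfl
    rw [hsum, hev, hev, pow_add]
    have hpos : 0 < (-1 : ℝ) ^ (k + 1) * ((u - r) ^ (k + 1) * (v - r) ^ (k + 1)) := by
      rw [← mul_pow, ← mul_pow]
      apply pow_pos
      nlinarith [mul_pos (sub_pos.2 hrI.1) (sub_pos.2 hrI.2)]
    calc (0 : ℝ) < _ := mul_pos hpos this
      _ = _ := by ring
  · push Not at hr
    rw [Finset.sum_eq_zero, pow_zero, one_mul]
    · by_contra hneg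
      have hneg' : F.eval u * F.eval v < 0 := lt_of_le_of_ne (not_lt.1 hneg) (mul_ne_zero hu hv)
      have hc : ContinuousOn (fun x => F.eval x) (uIcc u v) := F.continuous.continuousOn
      have h0 : (0 : ℝ) ∈ uIcc (F.eval u) (F.eval v) := by
        rw [mem_uIcc]
        rcases mul_neg_iff.1 hneg' with h | h
        · exact Or.inr ⟨h.2.le, h.1.le⟩
        · exact Or.inl ⟨h.1.le, h.2.le⟩
      obtain ⟨z, hz, hz0⟩ := intermediate_value_uIcc hc h0
      rw [uIcc_of_le huv.le] at hz
      refine hr z ⟨lt_of_le_of_ne hz.1 ?_, lt_of_le_of_ne hz.2 ?_⟩ hz0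
      · rintro rfl; exact hu hz0
      · rintro rfl; exact hv hz0
    · intro x hx
      exact rootMultiplicity_eq_zero (hr x (Finset.mem_filter.1 hx).2)

open Classical in
/-- A polynomial taking negative values arbitrarily near both ends of an interval has an even
number of zeros in it. -/
theorem even_sum_rootMultiplicity {U : Finset ℝ} {F : ℝ[X]} (hU : ∀ x, F.eval x = 0 → x ∈ U)
    {I : Set ℝ} (hI : I.OrdConnected) (hl : ∀ x ∈ I, ∃ u ∈ I, u ≤ x ∧ F.eval u < 0)
    (hr : ∀ x ∈ I, ∃ v ∈ I, x ≤ v ∧ F.eval v < 0) :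
    Even (∑ x ∈ U with x ∈ I, F.rootMultiplicity x) := by
  set S := {x ∈ U | x ∈ I ∧ F.eval x = 0} with hS
  rcases S.eq_empty_or_nonempty with he | hne
  · rw [Finset.sum_eq_zero]
    · exact Even.zero
    · intro x hx
      apply rootMultiplicity_eq_zero
      intro h0
      have : x ∈ S := by
        rw [hS, Finset.mem_filter]; exact ⟨hU x h0, (Finset.mem_filter.1 hx).2, h0⟩
      simp [he] at this
  have hmin := Finset.mem_filter.1 (S.min'_mem hne)
  have hmax := Finset.mem_filter.1 (S.max'_mem hne)
  obtain ⟨u, huI, hu, hFu⟩ := hl _ hmin.2.1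
  obtain ⟨v, hvI, hv, hFv⟩ := hr _ hmax.2.1
  have huv : u < v := by
    refine lt_of_le_of_ne ((hu.trans (S.min'_le_max' hne)).trans hv) ?_
    rintro rfl
    have : u = S.min' hne := le_antisymm hu ((S.min'_le_max' hne).trans hv)
    rw [this, hmin.2.2] at hFu
    exact lt_irrefl _ hFu
  have hsign := sign_eval_mul_eval U hU huv hFu.ne hFv.ne
  have hsum : ∑ x ∈ U with x ∈ I, F.rootMultiplicity x =
      ∑ x ∈ U with u < x ∧ x < v, F.rootMultiplicity x := by
    symm
    apply Finset.sum_subset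
    · intro x hx
      rw [Finset.mem_filter] at hx ⊢
      exact ⟨hx.1, hI.out huI hvI ⟨hx.2.1.le, hx.2.2.le⟩⟩
    · intro x hx hx'
      apply rootMultiplicity_eq_zero
      intro h0
      rw [Finset.mem_filter] at hx
      have hxS : x ∈ S := by
        rw [hS, Finset.mem_filter]; exact ⟨hU x h0, hx.2, h0⟩
      apply hx'
      rw [Finset.mem_filter]
      refine ⟨hx.1, lt_of_le_of_ne (hu.trans (S.min'_le x hxS)) ?_,
        lt_of_le_of_ne ((S.le_max' x hxS).trans hv) ?_⟩
      · rintro rfl; exact hFu.ne h0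
      · rintro rfl; exact hFv.ne h0
  rw [hsum]
  by_contra hodd
  rw [Nat.not_even_iff_odd] at hodd
  rw [hodd.neg_one_pow] at hsign
  nlinarith [mul_pos_of_neg_of_neg hFu hFv]

theorem even_sum_rootMultiplicity_univ {U : Finset ℝ} {F : ℝ[X]}
    (hU : ∀ x, F.eval x = 0 → x ∈ U) (hd : Even F.natDegree) (hl : F.leadingCoeff < 0) :
    Even (∑ x ∈ U, F.rootMultiplicity x) := by
  obtain ⟨h1, h2⟩ := eventually_neg_of_even_natDegree hd hl
  have := even_sum_rootMultiplicity hU (I := univ) ordConnected_univ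
    (fun x _ => by
      obtain ⟨u, hu⟩ := (h2.and (eventually_le_atBot x)).exists
      exact ⟨u, mem_univ _, hu.2, hu.1⟩)
    (fun x _ => by
      obtain ⟨u, hu⟩ := (h1.and (eventually_ge_atTop x)).exists
      exact ⟨u, mem_univ _, hu.2, hu.1⟩)
  simpa using this

/-! ### Counting interleaved points -/

/-- Rolle's theorem with multiplicities. The points of S ∪ R have one gap fewer than their number,
and each gap contains a point of T or a zero of g outside S. A point of S loses at most one in
passing from f to g, which accounts for the summand `S.card`. -/
theorem sum_add_card_le_of_interleaved {f g : ℝ → ℕ} {S R T V : Finset ℝ} (hSR : Disjoint S R)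
    (hV : ∀ x, g x ≠ 0 → x ∈ V) (hfg : ∀ x ∈ S, f x ≤ g x + 1)
    (h : ∀ x ∈ S ∪ R, ∀ y ∈ S ∪ R, x < y → (∀ z ∈ S ∪ R, z ∉ Ioo x y) →
      ∃ z ∈ Ioo x y, z ∈ T ∨ g z ≠ 0) :
    ∑ x ∈ S, f x + R.card ≤ ∑ x ∈ V, g x + T.card + 1 := by
  set W := V.filter (g · ≠ 0) with hW
  have h1 : (S ∪ R).card ≤ ((T ∪ W) \ (S ∪ R)).card + 1 := by
    apply Finset.card_le_sdiff_of_interleaved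
    intro x hx y hy hxy hz
    obtain ⟨z, hzI, hz⟩ := h x hx y hy hxy hz
    refine ⟨z, ?_, hzI.1, hzI.2⟩
    rw [Finset.mem_union, hW, Finset.mem_filter]
    exact hz.imp id fun h0 => ⟨hV z h0, h0⟩
  have h2 : ((T ∪ W) \ (S ∪ R)).card ≤ T.card + (W \ S).card := by
    refine le_trans (Finset.card_le_card (t := T ∪ (W \ S)) ?_) (Finset.card_union_le _ _)
    intro x
    simp only [Finset.mem_sdiff, Finset.mem_union]
    tauto
  have h3 : ∑ x ∈ S, f x ≤ ∑ x ∈ S, g x + S.card := by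
    rw [Finset.card_eq_sum_ones, ← Finset.sum_add_distrib]
    exact Finset.sum_le_sum hfg
  have h4 : ∑ x ∈ S, g x + (W \ S).card ≤ ∑ x ∈ V, g x := by
    have h5 : (W \ S).card ≤ ∑ x ∈ V \ S, g x := by
      rw [Finset.card_eq_sum_ones]
      refine le_trans (Finset.sum_le_sum (g := g) ?_) (Finset.sum_le_sum_of_subset ?_)
      · intro x hx
        rw [Finset.mem_sdiff, hW, Finset.mem_filter] at hx
        exact Nat.one_le_iff_ne_zero.2 hx.1.2
      · exact Finset.sdiff_subset_sdiff (Finset.filter_subset _ _) le_rfl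
    have h6 : ∑ x ∈ S, g x = ∑ x ∈ V ∩ S, g x := by
      symm
      apply Finset.sum_subset Finset.inter_subset_right
      intro x hx hx'
      by_contra h0
      exact hx' (Finset.mem_inter.2 ⟨hV x h0, hx⟩)
    rw [h6]
    have := Finset.sum_inter_add_sum_sdiff V S g
    omega
  rw [Finset.card_union_of_disjoint hSR] at h1
  omega

/-! ### Rolle and mean value arguments -/

theorem hasDerivAt_exp_mul_eval (b : ℝ) (p : ℝ[X]) (x : ℝ) :
    HasDerivAt (fun x => Real.exp (b * x) * p.eval x)
      (Real.exp (b * x) * (tiltDeriv b p).eval x) x := by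
  have h1 : HasDerivAt (fun x => Real.exp (b * x)) (Real.exp (b * x) * (b * 1)) x :=
    ((hasDerivAt_id x).const_mul b).exp
  convert! h1.mul (p.hasDerivAt x) using 1
  simp [tiltDeriv]
  ring

theorem hasDerivAt_tiltDeriv_div (b : ℝ) {p : ℝ[X]} {x : ℝ} (hx : p.eval x ≠ 0) :
    HasDerivAt (fun x => (tiltDeriv b p).eval x / p.eval x)
      ((laguerre p).eval x / p.eval x ^ 2) x := by
  convert! ((tiltDeriv b p).hasDerivAt x).div (p.hasDerivAt x) hx using 1
  rw [laguerre_eq_wronskian b]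
  simp only [eval_sub, eval_mul]
  ring

/-- Rolle for φ'/φ. -/
theorem exists_laguerre_eq_zero {b : ℝ} {p : ℝ[X]} {x y : ℝ} (hxy : x < y)
    (hp : ∀ z ∈ Icc x y, p.eval z ≠ 0) (hx : (tiltDeriv b p).eval x = 0)
    (hy : (tiltDeriv b p).eval y = 0) : ∃ z ∈ Ioo x y, (laguerre p).eval z = 0 := by
  obtain ⟨z, hz, h⟩ := exists_hasDerivAt_eq_zero hxy
    (fun z hz => (hasDerivAt_tiltDeriv_div b (hp z hz)).continuousAt.continuousWithinAt)
    (by simp [hx, hy]) fun z hz => hasDerivAt_tiltDeriv_div b (hp z (Ioo_subset_Icc_self hz))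
  refine ⟨z, hz, ?_⟩
  have := hp z (Ioo_subset_Icc_self hz)
  simpa [div_eq_zero_iff, this] using h

theorem exists_tiltDeriv_eq_zero (b : ℝ) {p : ℝ[X]} {x y : ℝ} (hxy : x < y)
    (hx : p.eval x = 0) (hy : p.eval y = 0) : ∃ z ∈ Ioo x y, (tiltDeriv b p).eval z = 0 := by
  obtain ⟨z, hz, h⟩ := exists_hasDerivAt_eq_zero hxy
    (fun z _ => (hasDerivAt_exp_mul_eval b p z).continuousAt.continuousWithinAt)
    (by simp [hx, hy]) fun z _ => hasDerivAt_exp_mul_eval b p z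
  exact ⟨z, hz, by simpa using h⟩

/-- Rolle for e^{bx} L/p₁ = φ²Q/φ'. -/
theorem exists_laguerre_tiltDeriv_eq_zero {b : ℝ} {p : ℝ[X]} {x y : ℝ} (hxy : x < y)
    (hp : ∀ z ∈ Ioo x y, p.eval z ≠ 0) (hp1 : ∀ z ∈ Icc x y, (tiltDeriv b p).eval z ≠ 0)
    (hx : (laguerre p).eval x = 0) (hy : (laguerre p).eval y = 0) :
    ∃ z ∈ Ioo x y, (laguerre (tiltDeriv b p)).eval z = 0 := by
  have hd : ∀ z ∈ Icc x y,
      HasDerivAt (fun z => Real.exp (b * z) * (laguerre p).eval z / (tiltDeriv b p).eval z)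
      (Real.exp (b * z) * (p.eval z * (laguerre (tiltDeriv b p)).eval z) /
        (tiltDeriv b p).eval z ^ 2) z := by
    intro z hz
    convert! (hasDerivAt_exp_mul_eval b (laguerre p) z).div ((tiltDeriv b p).hasDerivAt z)
      (hp1 z hz) using 1
    have := congrArg (eval z) (derivative_laguerre_mul_sub b p)
    simp only [eval_mul] at this
    rw [← this]
    conv_rhs => rw [tiltDeriv]
    simp only [eval_sub, eval_mul, eval_add, eval_C]
    ring
  obtain ⟨z, hz, h⟩ := exists_hasDerivAt_eq_zero hxy
    (fun z hz => (hd z hz).continuousAt.continuousWithinAt)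
    (by simp [hx, hy]) fun z hz => hd z (Ioo_subset_Icc_self hz)
  refine ⟨z, hz, ?_⟩
  have h1 := hp1 z (Ioo_subset_Icc_self hz)
  have h2 := hp z hz
  simpa [div_eq_zero_iff, h1, h2] using h

theorem hasDerivAt_sq_exp_mul_eval (b : ℝ) (p : ℝ[X]) (x : ℝ) :
    HasDerivAt (fun x => (Real.exp (b * x) * p.eval x) ^ 2)
      (2 * Real.exp (b * x) ^ 2 * (p * tiltDeriv b p).eval x) x := by
  convert! (hasDerivAt_exp_mul_eval b p x).pow 2 using 1
  simp
  ring

/-- φ² grows from 0 at a to a positive value at x, so its derivative 2φφ' is positive somewhere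
between; having no zero, φφ' stays positive up to x. -/
theorem eval_mul_tiltDeriv_pos {b : ℝ} {p : ℝ[X]} {a x : ℝ} (hax : a < x) (ha : p.eval a = 0)
    (h : ∀ z ∈ Ioc a x, (p * tiltDeriv b p).eval z ≠ 0) :
    0 < (p * tiltDeriv b p).eval x := by
  obtain ⟨z, hz, hd⟩ := exists_hasDerivAt_eq_slope _ _ hax
    (fun z _ => (hasDerivAt_sq_exp_mul_eval b p z).continuousAt.continuousWithinAt)
    fun z _ => hasDerivAt_sq_exp_mul_eval b p z
  have hpx : p.eval x ≠ 0 := fun h0 => h x ⟨hax, le_rfl⟩ (by simp [h0])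
  have hpos : 0 < (p * tiltDeriv b p).eval z := by
    have h1 : 0 < 2 * Real.exp (b * z) ^ 2 * (p * tiltDeriv b p).eval z := by
      rw [hd, ha]
      have := sub_pos.2 hax
      simp only [mul_zero, ne_eq, OfNat.ofNat_ne_zero, not_false_eq_true, zero_pow, sub_zero]
      positivity
    exact pos_of_mul_pos_right h1 (by positivity)
  by_contra hneg
  obtain ⟨w, hw, hw0⟩ := intermediate_value_Icc' hz.2.le
    (p * tiltDeriv b p).continuous.continuousOn ⟨not_lt.1 hneg, hpos.le⟩
  exact h w ⟨hz.1.trans_le hw.1, hw.2⟩ hw0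

theorem eval_mul_tiltDeriv_neg {b : ℝ} {p : ℝ[X]} {a x : ℝ} (hxa : x < a) (ha : p.eval a = 0)
    (h : ∀ z ∈ Ico x a, (p * tiltDeriv b p).eval z ≠ 0) :
    (p * tiltDeriv b p).eval x < 0 := by
  obtain ⟨z, hz, hd⟩ := exists_hasDerivAt_eq_slope _ _ hxa
    (fun z _ => (hasDerivAt_sq_exp_mul_eval b p z).continuousAt.continuousWithinAt)
    fun z _ => hasDerivAt_sq_exp_mul_eval b p z
  have hpx : p.eval x ≠ 0 := fun h0 => h x ⟨le_rfl, hxa⟩ (by simp [h0])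
  have hneg : (p * tiltDeriv b p).eval z < 0 := by
    have h1 : 2 * Real.exp (b * z) ^ 2 * (p * tiltDeriv b p).eval z < 0 := by
      rw [hd, ha]
      have := sub_pos.2 hxa
      simp only [mul_zero, ne_eq, OfNat.ofNat_ne_zero, not_false_eq_true, zero_pow, zero_sub]
      refine div_neg_of_neg_of_pos (neg_neg_of_pos ?_) this
      positivity
    exact neg_of_mul_neg_right h1 (by positivity)
  by_contra hpos
  obtain ⟨w, hw, hw0⟩ := intermediate_value_Icc' hz.1.le
    (p * tiltDeriv b p).continuous.continuousOn ⟨hneg.le, not_lt.1 hpos⟩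
  exact h w ⟨hw.1, hw.2.trans_lt hz.2⟩ hw0

/-- φ'/φ falls from a positive value at x to 0 at y, so its derivative Q is negative somewhere
between. -/
theorem exists_laguerre_neg_of_pos {b : ℝ} {p : ℝ[X]} {x y : ℝ} (hxy : x < y)
    (hp : ∀ z ∈ Icc x y, p.eval z ≠ 0) (hy : (tiltDeriv b p).eval y = 0)
    (hx : 0 < (p * tiltDeriv b p).eval x) : ∃ z ∈ Ioo x y, (laguerre p).eval z < 0 := by
  obtain ⟨z, hz, hd⟩ := exists_hasDerivAt_eq_slope _ _ hxy
    (fun z hz => (hasDerivAt_tiltDeriv_div b (hp z hz)).continuousAt.continuousWithinAt)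
    fun z hz => hasDerivAt_tiltDeriv_div b (hp z (Ioo_subset_Icc_self hz))
  refine ⟨z, hz, ?_⟩
  have hpz : 0 < p.eval z ^ 2 := by have := hp z (Ioo_subset_Icc_self hz); positivity
  have hpos : 0 < (tiltDeriv b p).eval x / p.eval x := by
    rw [div_pos_iff, ← mul_pos_iff, mul_comm, ← eval_mul]; exact hx
  have hneg : (laguerre p).eval z / p.eval z ^ 2 < 0 := by
    rw [hd, hy, zero_div, zero_sub]
    exact div_neg_of_neg_of_pos (neg_neg_of_pos hpos) (sub_pos.2 hxy)
  exact (div_neg_iff.1 hneg).resolve_left (fun h => h.2.not_gt hpz) |>.1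

theorem exists_laguerre_neg_of_neg {b : ℝ} {p : ℝ[X]} {x y : ℝ} (hxy : x < y)
    (hp : ∀ z ∈ Icc x y, p.eval z ≠ 0) (hx : (tiltDeriv b p).eval x = 0)
    (hy : (p * tiltDeriv b p).eval y < 0) : ∃ z ∈ Ioo x y, (laguerre p).eval z < 0 := by
  obtain ⟨z, hz, hd⟩ := exists_hasDerivAt_eq_slope _ _ hxy
    (fun z hz => (hasDerivAt_tiltDeriv_div b (hp z hz)).continuousAt.continuousWithinAt)
    fun z hz => hasDerivAt_tiltDeriv_div b (hp z (Ioo_subset_Icc_self hz))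
  refine ⟨z, hz, ?_⟩
  have hpz : 0 < p.eval z ^ 2 := by have := hp z (Ioo_subset_Icc_self hz); positivity
  have hpos : (tiltDeriv b p).eval y / p.eval y < 0 := by
    rw [div_neg_iff, ← mul_neg_iff, mul_comm, ← eval_mul]; exact hy
  have hneg : (laguerre p).eval z / p.eval z ^ 2 < 0 := by
    rw [hd, hx, zero_div, sub_zero]
    exact div_neg_of_neg_of_pos hpos (sub_pos.2 hxy)
  exact (div_neg_iff.1 hneg).resolve_left (fun h => h.2.not_gt hpz) |>.1

/-! ### Zeros of Q and the components around the zeros of φ -/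

open Classical in
/-- The multiplicity of `x` as a zero of `(p' / p)'`. -/
noncomputable def curvMult (p : ℝ[X]) (x : ℝ) : ℕ :=
  if p.eval x = 0 then 0 else (laguerre p).rootMultiplicity x

theorem curvMult_of_root {p : ℝ[X]} {x : ℝ} (h : p.eval x = 0) : curvMult p x = 0 := if_pos h

theorem curvMult_of_ne {p : ℝ[X]} {x : ℝ} (h : p.eval x ≠ 0) :
    curvMult p x = (laguerre p).rootMultiplicity x := if_neg h

theorem curvMult_ne_zero_iff {p : ℝ[X]} (h0 : laguerre p ≠ 0) {x : ℝ} :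
    curvMult p x ≠ 0 ↔ p.eval x ≠ 0 ∧ (laguerre p).eval x = 0 := by
  by_cases h : p.eval x = 0
  · simp [curvMult_of_root h, h]
  · rw [curvMult_of_ne h, ← Nat.pos_iff_ne_zero, rootMultiplicity_pos h0]
    simp [h]

/-- Rolle for φ between x and the next zero of p, so that the point found is not itself a zero of p.
-/
theorem exists_extra_tiltDeriv_eq_zero (b : ℝ) {p : ℝ[X]} (hp : p ≠ 0) {x y : ℝ} (hxy : x < y)
    (hx : p.eval x = 0) (hy : p.eval y = 0) :
    ∃ z ∈ Ioo x y, (tiltDeriv b p).eval z = 0 ∧ p.eval z ≠ 0 := by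
  classical
  have hmem : ∀ z, z ∈ p.roots.toFinset ↔ p.eval z = 0 := by simp [hp]
  obtain ⟨w, hw, hxw, hmin⟩ := Finset.exists_next_right (s := p.roots.toFinset) (x := x)
    ⟨y, (hmem y).2 hy, hxy⟩
  obtain ⟨z, hz, hz0⟩ := exists_tiltDeriv_eq_zero b hxw hx ((hmem w).1 hw)
  refine ⟨z, ⟨hz.1, hz.2.trans_le (hmin y ((hmem y).2 hy) hxy)⟩, hz0, fun h => ?_⟩
  exact (hmin z ((hmem z).2 h) hz.1).not_gt hz.2

/-- For a zero `a` of `p`, the largest interval around `a` containing no zero of `p' + b p` other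
than multiple zeros of `p`. -/
def critComponent (b : ℝ) (p : ℝ[X]) (a : ℝ) : Set ℝ :=
  {x | ∀ z ∈ uIcc a x, (tiltDeriv b p).eval z = 0 → p.eval z = 0}

section critComponent

variable {b : ℝ} {p : ℝ[X]} {a x y : ℝ}

theorem self_mem_critComponent (ha : p.eval a = 0) : a ∈ critComponent b p a := by
  intro z hz _
  rw [uIcc_self, mem_singleton_iff] at hz
  rw [hz, ha]

theorem critComponent_extend (hx : x ∈ critComponent b p a)
    (h : ∀ z ∈ uIcc x y, (tiltDeriv b p).eval z = 0 → p.eval z = 0) :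
    y ∈ critComponent b p a := by
  intro z hz
  rcases uIcc_subset_uIcc_union_uIcc hz with hz | hz
  · exact hx z hz
  · exact h z hz

theorem ordConnected_critComponent : (critComponent b p a).OrdConnected := by
  refine ⟨fun x hx y hy z hz w hw => ?_⟩
  rcases le_total z a with h | h
  · rw [uIcc_of_ge h] at hw
    refine hx w ?_
    rw [uIcc_of_ge (hz.1.trans h)]
    exact ⟨hz.1.trans hw.1, hw.2⟩
  · rw [uIcc_of_le h] at hw
    refine hy w ?_
    rw [uIcc_of_le (h.trans hz.2)]
    exact ⟨hw.1, hw.2.trans hz.2⟩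

theorem eval_ne_zero_of_mem_critComponent (hp : p ≠ 0) (ha : p.eval a = 0)
    (hx : x ∈ critComponent b p a) (hxa : x ≠ a) :
    p.eval x ≠ 0 ∧ (tiltDeriv b p).eval x ≠ 0 := by
  have h : p.eval x ≠ 0 := by
    intro h0
    rcases lt_or_gt_of_ne hxa with h | h
    · obtain ⟨z, hz, h1, h2⟩ := exists_extra_tiltDeriv_eq_zero b hp h h0 ha
      exact h2 (hx z (by rw [uIcc_of_ge h.le]; exact Ioo_subset_Icc_self hz) h1)
    · obtain ⟨z, hz, h1, h2⟩ := exists_extra_tiltDeriv_eq_zero b hp h ha h0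
      exact h2 (hx z (by rw [uIcc_of_le h.le]; exact Ioo_subset_Icc_self hz) h1)
  exact ⟨h, fun h1 => h (hx x right_mem_uIcc h1)⟩

/-- To the right, a component ends at an extra zero of φ' or is unbounded. -/
theorem critComponent_right (h1 : tiltDeriv b p ≠ 0) (hx : x ∈ critComponent b p a) :
    (∃ y > x, (tiltDeriv b p).eval y = 0 ∧ p.eval y ≠ 0 ∧
      ∀ z ∈ Ico x y, z ∈ critComponent b p a) ∨ ∀ z ≥ x, z ∈ critComponent b p a := by
  classical
  set s := {z ∈ (tiltDeriv b p).roots.toFinset | p.eval z ≠ 0} with hs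
  have hmem : ∀ z, z ∈ s ↔ (tiltDeriv b p).eval z = 0 ∧ p.eval z ≠ 0 := by simp [hs, h1]
  by_cases h : ∃ y ∈ s, x < y
  · left
    obtain ⟨y, hy, hxy, hmin⟩ := Finset.exists_next_right h
    refine ⟨y, hxy, ((hmem y).1 hy).1, ((hmem y).1 hy).2, fun z hz => ?_⟩
    refine critComponent_extend hx fun w hw hw0 => ?_
    rw [uIcc_of_le hz.1] at hw
    rcases hw.1.eq_or_lt with rfl | hxw
    · exact hx _ right_mem_uIcc hw0
    · by_contra hpw
      exact (hmin w ((hmem w).2 ⟨hw0, hpw⟩) hxw).not_gt (hw.2.trans_lt hz.2)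
  · right
    push Not at h
    refine fun z hz => critComponent_extend hx fun w hw hw0 => ?_
    rw [uIcc_of_le hz] at hw
    rcases hw.1.eq_or_lt with rfl | hxw
    · exact hx _ right_mem_uIcc hw0
    · by_contra hpw
      exact (h w ((hmem w).2 ⟨hw0, hpw⟩)).not_gt hxw

theorem critComponent_left (h1 : tiltDeriv b p ≠ 0) (hx : x ∈ critComponent b p a) :
    (∃ y < x, (tiltDeriv b p).eval y = 0 ∧ p.eval y ≠ 0 ∧
      ∀ z ∈ Ioc y x, z ∈ critComponent b p a) ∨ ∀ z ≤ x, z ∈ critComponent b p a := by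
  classical
  set s := {z ∈ (tiltDeriv b p).roots.toFinset | p.eval z ≠ 0} with hs
  have hmem : ∀ z, z ∈ s ↔ (tiltDeriv b p).eval z = 0 ∧ p.eval z ≠ 0 := by simp [hs, h1]
  by_cases h : ∃ y ∈ s, y < x
  · left
    obtain ⟨y, hy, hxy, hmin⟩ := Finset.exists_next_left h
    refine ⟨y, hxy, ((hmem y).1 hy).1, ((hmem y).1 hy).2, fun z hz => ?_⟩
    refine critComponent_extend hx fun w hw hw0 => ?_
    rw [uIcc_of_ge hz.2] at hw
    rcases hw.2.eq_or_lt with rfl | hxw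
    · exact hx _ right_mem_uIcc hw0
    · by_contra hpw
      exact (hmin w ((hmem w).2 ⟨hw0, hpw⟩) hxw).not_gt (hz.1.trans_le hw.1)
  · right
    push Not at h
    refine fun z hz => critComponent_extend hx fun w hw hw0 => ?_
    rw [uIcc_of_ge hz] at hw
    rcases hw.2.eq_or_lt with rfl | hxw
    · exact hx _ right_mem_uIcc hw0
    · by_contra hpw
      exact (h w ((hmem w).2 ⟨hw0, hpw⟩)).not_gt hxw

theorem exists_right_laguerre_neg {q : ℝ[X]} (hq : q ≠ 0) (hqa : q.eval a = 0) (hax : a < x) :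
    ∃ u ∈ Ioo a x, (laguerre q).eval u < 0 := by
  have h1 : ∀ᶠ u in 𝓝[>] a, (laguerre q).eval u < 0 :=
    (eventually_laguerre_neg hq hqa).filter_mono (nhdsWithin_mono _ fun u hu => ne_of_gt hu)
  obtain ⟨u, hu, hu'⟩ := (h1.and (Ioo_mem_nhdsGT hax)).exists
  exact ⟨u, hu', hu⟩

theorem exists_left_laguerre_neg {q : ℝ[X]} (hq : q ≠ 0) (hqa : q.eval a = 0) (hax : x < a) :
    ∃ u ∈ Ioo x a, (laguerre q).eval u < 0 := by
  have h1 : ∀ᶠ u in 𝓝[<] a, (laguerre q).eval u < 0 :=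
    (eventually_laguerre_neg hq hqa).filter_mono (nhdsWithin_mono _ fun u hu => ne_of_lt hu)
  obtain ⟨u, hu, hu'⟩ := (h1.and (Ioo_mem_nhdsLT hax)).exists
  exact ⟨u, hu', hu⟩

theorem exists_ge_laguerre_neg {q : ℝ[X]} (hq : 0 < q.natDegree) (x : ℝ) :
    ∃ u ≥ x, (laguerre q).eval u < 0 := by
  obtain ⟨-, h1, h2⟩ := natDegree_leadingCoeff_laguerre hq
  exact (((eventually_neg_of_even_natDegree h1 h2).1.and (eventually_ge_atTop x)).exists).imp
    fun _ h => ⟨h.2, h.1⟩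

theorem exists_le_laguerre_neg {q : ℝ[X]} (hq : 0 < q.natDegree) (x : ℝ) :
    ∃ u ≤ x, (laguerre q).eval u < 0 := by
  obtain ⟨-, h1, h2⟩ := natDegree_leadingCoeff_laguerre hq
  exact (((eventually_neg_of_even_natDegree h1 h2).2.and (eventually_le_atBot x)).exists).imp
    fun _ h => ⟨h.2, h.1⟩

theorem critComponent_exists_ge_laguerre_tiltDeriv_neg (h1 : 0 < (tiltDeriv b p).natDegree)
    (hx : x ∈ critComponent b p a) :
    ∃ v ∈ critComponent b p a, x ≤ v ∧ (laguerre (tiltDeriv b p)).eval v < 0 := by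
  have h0 := ne_zero_of_natDegree_gt h1
  rcases critComponent_right h0 hx with ⟨y, hxy, hy, -, hI⟩ | hI
  · obtain ⟨v, hv, hneg⟩ := exists_left_laguerre_neg h0 hy hxy
    exact ⟨v, hI v (Ioo_subset_Ico_self hv), hv.1.le, hneg⟩
  · obtain ⟨v, hv, hneg⟩ := exists_ge_laguerre_neg h1 x
    exact ⟨v, hI v hv, hv, hneg⟩

theorem critComponent_exists_le_laguerre_tiltDeriv_neg (h1 : 0 < (tiltDeriv b p).natDegree)
    (hx : x ∈ critComponent b p a) :
    ∃ v ∈ critComponent b p a, v ≤ x ∧ (laguerre (tiltDeriv b p)).eval v < 0 := by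
  have h0 := ne_zero_of_natDegree_gt h1
  rcases critComponent_left h0 hx with ⟨y, hxy, hy, -, hI⟩ | hI
  · obtain ⟨v, hv, hneg⟩ := exists_right_laguerre_neg h0 hy hxy
    exact ⟨v, hI v (Ioo_subset_Ioc_self hv), hv.2.le, hneg⟩
  · obtain ⟨v, hv, hneg⟩ := exists_le_laguerre_neg h1 x
    exact ⟨v, hI v hv, hv, hneg⟩

/-- If the component ends at an extra zero of φ', then φ'/φ is positive to the right of a and 0 at
that end, so it decreases somewhere beyond x. If the component is unbounded, the leading term of L
decides. -/
theorem critComponent_exists_ge_laguerre_neg (hp : 0 < p.natDegree) (h1 : tiltDeriv b p ≠ 0)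
    (ha : p.eval a = 0) (hax : a < x) (hx : x ∈ critComponent b p a) :
    ∃ v ∈ critComponent b p a, x ≤ v ∧ (laguerre p).eval v < 0 := by
  have hp0 := ne_zero_of_natDegree_gt hp
  have hne : ∀ z ∈ Ioc a x, (p * tiltDeriv b p).eval z ≠ 0 := by
    intro z hz
    rw [eval_mul]
    have hzI : z ∈ critComponent b p a := ordConnected_critComponent.out
      (self_mem_critComponent ha) hx ⟨hz.1.le, hz.2⟩
    obtain ⟨h2, h3⟩ := eval_ne_zero_of_mem_critComponent hp0 ha hzI hz.1.ne'
    exact mul_ne_zero h2 h3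
  rcases critComponent_right h1 hx with ⟨y, hxy, hy, hpy, hI⟩ | hI
  · obtain ⟨v, hv, hneg⟩ := exists_laguerre_neg_of_pos hxy (fun z hz => by
      rcases hz.2.eq_or_lt with rfl | h
      · exact hpy
      · exact (eval_ne_zero_of_mem_critComponent hp0 ha (hI z ⟨hz.1, h⟩)
          (hax.trans_le hz.1).ne').1) hy (eval_mul_tiltDeriv_pos hax ha hne)
    exact ⟨v, hI v (Ioo_subset_Ico_self hv), hv.1.le, hneg⟩
  · obtain ⟨v, hv, hneg⟩ := exists_ge_laguerre_neg hp x
    exact ⟨v, hI v hv, hv, hneg⟩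

theorem critComponent_exists_le_laguerre_neg (hp : 0 < p.natDegree) (h1 : tiltDeriv b p ≠ 0)
    (ha : p.eval a = 0) (hax : x < a) (hx : x ∈ critComponent b p a) :
    ∃ v ∈ critComponent b p a, v ≤ x ∧ (laguerre p).eval v < 0 := by
  have hp0 := ne_zero_of_natDegree_gt hp
  have hne : ∀ z ∈ Ico x a, (p * tiltDeriv b p).eval z ≠ 0 := by
    intro z hz
    rw [eval_mul]
    have hzI : z ∈ critComponent b p a := ordConnected_critComponent.out
      hx (self_mem_critComponent ha) ⟨hz.1, hz.2.le⟩
    obtain ⟨h2, h3⟩ := eval_ne_zero_of_mem_critComponent hp0 ha hzI hz.2.ne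
    exact mul_ne_zero h2 h3
  rcases critComponent_left h1 hx with ⟨y, hxy, hy, hpy, hI⟩ | hI
  · obtain ⟨v, hv, hneg⟩ := exists_laguerre_neg_of_neg hxy (fun z hz => by
      rcases hz.1.eq_or_lt with rfl | h
      · exact hpy
      · exact (eval_ne_zero_of_mem_critComponent hp0 ha (hI z ⟨h, hz.2⟩)
          (hz.2.trans_lt hax).ne).1) hy (eval_mul_tiltDeriv_neg hax ha hne)
    exact ⟨v, hI v (Ioo_subset_Ioc_self hv), hv.2.le, hneg⟩
  · obtain ⟨v, hv, hneg⟩ := exists_le_laguerre_neg hp x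
    exact ⟨v, hI v hv, hv, hneg⟩

end critComponent

/-! ### Zeros of Q against zeros of Q₁ inside a component -/

-- Rolle on J gives the inequality up to one, and parity removes the one. J' may exceed J because
-- the parity for Q₁ may be available only on a larger interval.
open Classical in
theorem sum_curvMult_le_of_even {b : ℝ} {p : ℝ[X]} {U : Finset ℝ}
    (h1 : laguerre (tiltDeriv b p) ≠ 0)
    (hU1 : ∀ x, (laguerre (tiltDeriv b p)).eval x = 0 → x ∈ U) {J J' : Set ℝ}
    (hJ : J.OrdConnected) (hJJ' : J ⊆ J') (hpJ : ∀ x ∈ J, p.eval x ≠ 0)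
    (hp1J : ∀ x ∈ J', (tiltDeriv b p).eval x ≠ 0)
    (he : Even (∑ x ∈ U with x ∈ J, (laguerre p).rootMultiplicity x))
    (he1 : Even (∑ x ∈ U with x ∈ J', (laguerre (tiltDeriv b p)).rootMultiplicity x)) :
    ∑ x ∈ U with x ∈ J, curvMult p x ≤ ∑ x ∈ U with x ∈ J', curvMult (tiltDeriv b p) x := by
  have e0 : ∑ x ∈ U with x ∈ J, curvMult p x =
      ∑ x ∈ U with x ∈ J, (laguerre p).rootMultiplicity x :=
    Finset.sum_congr rfl fun x hx => curvMult_of_ne (hpJ x (Finset.mem_filter.1 hx).2)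
  have e1 : ∑ x ∈ U with x ∈ J', curvMult (tiltDeriv b p) x =
      ∑ x ∈ U with x ∈ J', (laguerre (tiltDeriv b p)).rootMultiplicity x :=
    Finset.sum_congr rfl fun x hx => curvMult_of_ne (hp1J x (Finset.mem_filter.1 hx).2)
  have key : ∑ x ∈ U with x ∈ J ∧ (laguerre p).eval x = 0, (laguerre p).rootMultiplicity x
      + (∅ : Finset ℝ).card ≤
      ∑ x ∈ U, (if x ∈ J then (laguerre (tiltDeriv b p)).rootMultiplicity x else 0)
        + (∅ : Finset ℝ).card + 1 := by
    apply sum_add_card_le_of_interleaved (Finset.disjoint_empty_right _)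
    · intro x hx
      apply hU1
      by_contra hne
      rw [rootMultiplicity_eq_zero hne] at hx
      simp at hx
    · intro x hx
      have hxJ := (Finset.mem_filter.1 hx).2.1
      rw [if_pos hxJ]
      exact rootMultiplicity_laguerre_le_add_one h1 (hpJ x hxJ)
    · intro x hx y hy hxy _
      simp only [Finset.union_empty, Finset.mem_filter] at hx hy
      have hsub : Icc x y ⊆ J := hJ.out hx.2.1 hy.2.1
      obtain ⟨z, hz, hz0⟩ := exists_laguerre_tiltDeriv_eq_zero hxy
        (fun z hz => hpJ z (hsub (Ioo_subset_Icc_self hz)))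
        (fun z hz => hp1J z (hJJ' (hsub hz))) hx.2.2 hy.2.2
      refine ⟨z, hz, Or.inr ?_⟩
      rw [if_pos (hsub (Ioo_subset_Icc_self hz))]
      exact ((rootMultiplicity_pos h1).2 hz0).ne'
  have e2 : ∑ x ∈ U with x ∈ J ∧ (laguerre p).eval x = 0, (laguerre p).rootMultiplicity x =
      ∑ x ∈ U with x ∈ J, (laguerre p).rootMultiplicity x := by
    apply Finset.sum_subset
    · intro x hx
      rw [Finset.mem_filter] at hx ⊢
      exact ⟨hx.1, hx.2.1⟩
    · intro x hx hx'
      rw [Finset.mem_filter] at hx hx'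
      exact rootMultiplicity_eq_zero fun h => hx' ⟨hx.1, hx.2, h⟩
  rw [← Finset.sum_filter, e2] at key
  have e3 : ∑ x ∈ U with x ∈ J, (laguerre (tiltDeriv b p)).rootMultiplicity x ≤
      ∑ x ∈ U with x ∈ J', (laguerre (tiltDeriv b p)).rootMultiplicity x :=
    Finset.sum_le_sum_of_subset (Finset.monotone_filter_right _ fun x _ hx => hJJ' hx)
  rw [e0, e1]
  obtain ⟨k, hk⟩ := he
  obtain ⟨l, hl⟩ := he1
  simp only [Finset.card_empty] at key
  omega

open Classical in
theorem sum_curvMult_critComponent_le {b : ℝ} (hb : b ≠ 0) {p : ℝ[X]} (hp : 0 < p.natDegree)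
    {U : Finset ℝ} (hU : ∀ x, (laguerre p).eval x = 0 → x ∈ U)
    (hU1 : ∀ x, (laguerre (tiltDeriv b p)).eval x = 0 → x ∈ U) {a : ℝ} (ha : p.eval a = 0)
    (hA : (∀ x ∈ critComponent b p a, x < a → curvMult p x = 0) ∨
      ∀ x ∈ critComponent b p a, a < x → curvMult p x = 0) :
    ∑ x ∈ U with x ∈ critComponent b p a, curvMult p x ≤
      ∑ x ∈ U with x ∈ critComponent b p a, curvMult (tiltDeriv b p) x := by
  have hp0 := ne_zero_of_natDegree_gt hp
  have hp1 : 0 < (tiltDeriv b p).natDegree := by rwa [(natDegree_leadingCoeff_tiltDeriv hb p).1]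
  have hp10 := ne_zero_of_natDegree_gt hp1
  have h1 := (natDegree_leadingCoeff_laguerre hp1).1
  set I := critComponent b p a with hI
  have haI : a ∈ I := self_mem_critComponent ha
  have hIo : I.OrdConnected := ordConnected_critComponent
  -- J is the part of the component on the side of a where property A allows zeros of Q.
  suffices h : ∃ J ⊆ I, J.OrdConnected ∧ a ∉ J ∧ (∀ x ∈ I, x ∉ J → curvMult p x = 0) ∧
      Even (∑ x ∈ U with x ∈ J, (laguerre p).rootMultiplicity x) ∧
      ((tiltDeriv b p).eval a = 0 →
        Even (∑ x ∈ U with x ∈ J, (laguerre (tiltDeriv b p)).rootMultiplicity x)) by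
    obtain ⟨J, hJI, hJ, haJ, hJ0, he, he1⟩ := h
    have hne : ∀ x ∈ J, p.eval x ≠ 0 ∧ (tiltDeriv b p).eval x ≠ 0 := fun x hx =>
      eval_ne_zero_of_mem_critComponent hp0 ha (hJI hx) fun h => haJ (h ▸ hx)
    have e : ∑ x ∈ U with x ∈ I, curvMult p x = ∑ x ∈ U with x ∈ J, curvMult p x := by
      symm
      apply Finset.sum_subset (Finset.monotone_filter_right _ fun x _ hx => hJI hx)
      intro x hx hx'
      rw [Finset.mem_filter] at hx hx'
      exact hJ0 x hx.2 fun h => hx' ⟨hx.1, h⟩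
    rw [e]
    -- If φ'(a) = 0, then L₁ is negative near a and its zeros in J are even in number. Otherwise a
    -- is no barrier for Q₁, and the parity is that on all of I.
    by_cases ha1 : (tiltDeriv b p).eval a = 0
    · refine (sum_curvMult_le_of_even h1 hU1 hJ le_rfl (fun x hx => (hne x hx).1)
        (fun x hx => (hne x hx).2) he (he1 ha1)).trans ?_
      exact Finset.sum_le_sum_of_subset (Finset.monotone_filter_right _ fun x _ hx => hJI hx)
    · refine sum_curvMult_le_of_even h1 hU1 hJ hJI (fun x hx => (hne x hx).1)
        (fun x hx => ?_) he ?_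
      · rcases eq_or_ne x a with rfl | hxa
        · exact ha1
        · exact (eval_ne_zero_of_mem_critComponent hp0 ha hx hxa).2
      · exact even_sum_rootMultiplicity hU1 hIo
          (fun x hx => critComponent_exists_le_laguerre_tiltDeriv_neg hp1 hx)
          (fun x hx => critComponent_exists_ge_laguerre_tiltDeriv_neg hp1 hx)
  rcases hA with hA | hA
  · refine ⟨I ∩ Ioi a, inter_subset_left, hIo.inter ordConnected_Ioi, fun h => lt_irrefl a h.2,
      fun x hx hx' => ?_, ?_, fun ha1 => ?_⟩
    · rcases lt_trichotomy x a with h | rfl | h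
      · exact hA x hx h
      · exact curvMult_of_root ha
      · exact absurd ⟨hx, h⟩ hx'
    · refine even_sum_rootMultiplicity hU (hIo.inter ordConnected_Ioi) ?_ ?_
      · rintro x ⟨hx, hax⟩
        obtain ⟨u, hu, hneg⟩ := exists_right_laguerre_neg hp0 ha hax
        exact ⟨u, ⟨hIo.out haI hx (Ioo_subset_Icc_self hu), hu.1⟩, hu.2.le, hneg⟩
      · rintro x ⟨hx, hax⟩
        obtain ⟨v, hv, hxv, hneg⟩ := critComponent_exists_ge_laguerre_neg hp hp10 ha hax hx
        exact ⟨v, ⟨hv, lt_of_lt_of_le hax hxv⟩, hxv, hneg⟩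
    · refine even_sum_rootMultiplicity hU1 (hIo.inter ordConnected_Ioi) ?_ ?_
      · rintro x ⟨hx, hax⟩
        obtain ⟨u, hu, hneg⟩ := exists_right_laguerre_neg hp10 ha1 hax
        exact ⟨u, ⟨hIo.out haI hx (Ioo_subset_Icc_self hu), hu.1⟩, hu.2.le, hneg⟩
      · rintro x ⟨hx, hax⟩
        obtain ⟨v, hv, hxv, hneg⟩ := critComponent_exists_ge_laguerre_tiltDeriv_neg hp1 hx
        exact ⟨v, ⟨hv, lt_of_lt_of_le hax hxv⟩, hxv, hneg⟩
  · refine ⟨I ∩ Iio a, inter_subset_left, hIo.inter ordConnected_Iio, fun h => lt_irrefl a h.2,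
      fun x hx hx' => ?_, ?_, fun ha1 => ?_⟩
    · rcases lt_trichotomy x a with h | rfl | h
      · exact absurd ⟨hx, h⟩ hx'
      · exact curvMult_of_root ha
      · exact hA x hx h
    · refine even_sum_rootMultiplicity hU (hIo.inter ordConnected_Iio) ?_ ?_
      · rintro x ⟨hx, hax⟩
        obtain ⟨v, hv, hxv, hneg⟩ := critComponent_exists_le_laguerre_neg hp hp10 ha hax hx
        exact ⟨v, ⟨hv, lt_of_le_of_lt hxv hax⟩, hxv, hneg⟩
      · rintro x ⟨hx, hax⟩
        obtain ⟨u, hu, hneg⟩ := exists_left_laguerre_neg hp0 ha hax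
        exact ⟨u, ⟨hIo.out hx haI (Ioo_subset_Icc_self hu), hu.2⟩, hu.1.le, hneg⟩
    · refine even_sum_rootMultiplicity hU1 (hIo.inter ordConnected_Iio) ?_ ?_
      · rintro x ⟨hx, hax⟩
        obtain ⟨v, hv, hxv, hneg⟩ := critComponent_exists_le_laguerre_tiltDeriv_neg hp1 hx
        exact ⟨v, ⟨hv, lt_of_le_of_lt hxv hax⟩, hxv, hneg⟩
      · rintro x ⟨hx, hax⟩
        obtain ⟨u, hu, hneg⟩ := exists_left_laguerre_neg hp10 ha1 hax
        exact ⟨u, ⟨hIo.out hx haI (Ioo_subset_Icc_self hu), hu.2⟩, hu.1.le, hneg⟩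

/-! ### Global parities and inequalities -/

open Classical in
/-- The zeros of `p' + b p` in `U` that are not zeros of `p`. -/
noncomputable def extraRoots (b : ℝ) (p : ℝ[X]) (U : Finset ℝ) : Finset ℝ :=
  {x ∈ U | (tiltDeriv b p).eval x = 0 ∧ p.eval x ≠ 0}

theorem mem_extraRoots {b : ℝ} {p : ℝ[X]} {U : Finset ℝ} {x : ℝ} :
    x ∈ extraRoots b p U ↔ x ∈ U ∧ (tiltDeriv b p).eval x = 0 ∧ p.eval x ≠ 0 := by
  simp [extraRoots]

open Classical in
theorem even_sum_curvMult {p : ℝ[X]} (hp : 0 < p.natDegree) {U : Finset ℝ}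
    (hU : ∀ x, (laguerre p).eval x = 0 → x ∈ U) : Even (∑ x ∈ U, curvMult p x) := by
  obtain ⟨-, h1, h2⟩ := natDegree_leadingCoeff_laguerre hp
  have he := even_sum_rootMultiplicity_univ hU h1 h2
  have hs : ∑ x ∈ U, (laguerre p).rootMultiplicity x =
      ∑ x ∈ U, curvMult p x + 2 * ∑ x ∈ U, (if p.eval x = 0 then
        p.rootMultiplicity x - 1 else 0) := by
    rw [Finset.mul_sum, ← Finset.sum_add_distrib]
    refine Finset.sum_congr rfl fun x _ => ?_
    split_ifs with h
    · rw [curvMult_of_root h]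
      have := rootMultiplicity_laguerre_of_root (ne_zero_of_natDegree_gt hp) h
      omega
    · rw [curvMult_of_ne h, mul_zero, add_zero]
  rw [hs] at he
  exact (Nat.even_add.1 he).2 (even_two_mul _)

-- The polynomial -b p p₁ has even degree and negative leading coefficient, hence an even number of
-- real zeros. A zero of p of order m counts m + (m - 1) times, which is odd.
open Classical in
theorem even_card_roots_add_sum_extraRoots {b : ℝ} (hb : b ≠ 0) {p : ℝ[X]}
    (hp : 0 < p.natDegree) {U : Finset ℝ} (hUp : ∀ x, p.eval x = 0 → x ∈ U)
    (hUp1 : ∀ x, (tiltDeriv b p).eval x = 0 → x ∈ U) :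
    Even ({x ∈ U | p.eval x = 0}.card +
      ∑ x ∈ extraRoots b p U, (tiltDeriv b p).rootMultiplicity x) := by
  have hp0 := ne_zero_of_natDegree_gt hp
  obtain ⟨hd, hl⟩ := natDegree_leadingCoeff_tiltDeriv hb p
  have hp1 : tiltDeriv b p ≠ 0 := ne_zero_of_natDegree_gt (hd ▸ hp)
  have hpp1 := mul_ne_zero hp0 hp1
  have hb' : -b ≠ 0 := neg_ne_zero.2 hb
  have hlc : p.leadingCoeff ≠ 0 := leadingCoeff_ne_zero.2 hp0
  have he : Even (∑ x ∈ U, (C (-b) * (p * tiltDeriv b p)).rootMultiplicity x) := by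
    apply even_sum_rootMultiplicity_univ
    · intro x hx
      rw [eval_mul, eval_C, eval_mul] at hx
      rcases mul_eq_zero.1 ((mul_eq_zero.1 hx).resolve_left hb') with h | h
      · exact hUp x h
      · exact hUp1 x h
    · rw [natDegree_C_mul hb', natDegree_mul hp0 hp1, hd]
      exact ⟨_, rfl⟩
    · rw [leadingCoeff_mul, leadingCoeff_C, leadingCoeff_mul, hl]
      have : 0 < (b * p.leadingCoeff) ^ 2 := by positivity
      linarith
  have hs : ∑ x ∈ U, (C (-b) * (p * tiltDeriv b p)).rootMultiplicity x =
      2 * (∑ x ∈ U with p.eval x = 0, (p.rootMultiplicity x - 1)) +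
        ({x ∈ U | p.eval x = 0}.card +
          ∑ x ∈ extraRoots b p U, (tiltDeriv b p).rootMultiplicity x) := by
    rw [Finset.card_eq_sum_ones, extraRoots, Finset.sum_filter, Finset.sum_filter,
      Finset.sum_filter, Finset.mul_sum, ← Finset.sum_add_distrib, ← Finset.sum_add_distrib]
    refine Finset.sum_congr rfl fun x _ => ?_
    rw [rootMultiplicity_mul (mul_ne_zero (C_ne_zero.2 hb') hpp1), rootMultiplicity_C,
      rootMultiplicity_mul hpp1, zero_add]
    by_cases h : p.eval x = 0
    · have := rootMultiplicity_tiltDeriv_of_root b hp0 h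
      simp only [h, if_true, ne_eq, not_true_eq_false, and_false, if_false]
      omega
    · rw [rootMultiplicity_eq_zero h]
      by_cases h1 : (tiltDeriv b p).eval x = 0
      · simp [h, h1]
      · simp [h, h1, rootMultiplicity_eq_zero h1]
  rw [hs] at he
  exact (Nat.even_add.1 he).1 (even_two_mul _)

-- Consecutive extra zeros of φ' are separated by a zero of φ or, by Rolle for φ'/φ, by a zero of Q.
open Classical in
theorem sum_extraRoots_le {b : ℝ} {p : ℝ[X]}
    (hp : 0 < p.natDegree) {U : Finset ℝ} (hUp : ∀ x, p.eval x = 0 → x ∈ U)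
    (hU : ∀ x, (laguerre p).eval x = 0 → x ∈ U) :
    ∑ x ∈ extraRoots b p U, (tiltDeriv b p).rootMultiplicity x ≤
      ∑ x ∈ U, curvMult p x + {x ∈ U | p.eval x = 0}.card + 1 := by
  have h0 := (natDegree_leadingCoeff_laguerre hp).1
  rw [← Nat.add_zero (∑ x ∈ extraRoots b p U, _), ← Finset.card_empty (α := ℝ)]
  apply sum_add_card_le_of_interleaved (Finset.disjoint_empty_right _)
  · intro x hx
    exact hU x ((curvMult_ne_zero_iff h0).1 hx).2
  · intro x hx
    rw [curvMult_of_ne (mem_extraRoots.1 hx).2.2]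
    exact rootMultiplicity_le_laguerre_add_one h0 x
  · intro x hx y hy hxy _
    rw [Finset.union_empty, mem_extraRoots] at hx hy
    by_cases h : ∃ z ∈ Ioo x y, p.eval z = 0
    · obtain ⟨z, hz, hz0⟩ := h
      exact ⟨z, hz, Or.inl (Finset.mem_filter.2 ⟨hUp z hz0, hz0⟩)⟩
    · push Not at h
      have hne : ∀ z ∈ Icc x y, p.eval z ≠ 0 := by
        intro z hz
        rcases hz.1.eq_or_lt with rfl | h1
        · exact hx.2.2
        rcases hz.2.eq_or_lt with rfl | h2
        · exact hy.2.2
        exact h z ⟨h1, h2⟩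
      obtain ⟨z, hz, hz0⟩ := exists_laguerre_eq_zero hxy hne hx.2.1 hy.2.1
      exact ⟨z, hz, Or.inr ((curvMult_ne_zero_iff h0).2 ⟨hne z (Ioo_subset_Icc_self hz), hz0⟩)⟩

open Classical in
theorem sum_curvMult_outside_add_card_le {b : ℝ} (hb : b ≠ 0) {p : ℝ[X]}
    (hp : 0 < p.natDegree) {U : Finset ℝ} (hUp : ∀ x, p.eval x = 0 → x ∈ U)
    (hUp1 : ∀ x, (tiltDeriv b p).eval x = 0 → x ∈ U)
    (hU1 : ∀ x, (laguerre (tiltDeriv b p)).eval x = 0 → x ∈ U) :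
    ∑ x ∈ U with p.eval x ≠ 0 ∧ (tiltDeriv b p).eval x ≠ 0 ∧ (laguerre p).eval x = 0 ∧
        ∀ a, p.eval a = 0 → x ∉ critComponent b p a, (laguerre p).rootMultiplicity x
      + {x ∈ U | p.eval x = 0}.card ≤
    ∑ x ∈ U, (if ∀ a, p.eval a = 0 → x ∉ critComponent b p a then
        curvMult (tiltDeriv b p) x else 0) + (extraRoots b p U).card + 1 := by
  have hp0 := ne_zero_of_natDegree_gt hp
  have hp1 : 0 < (tiltDeriv b p).natDegree := by rwa [(natDegree_leadingCoeff_tiltDeriv hb p).1]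
  have h1 := (natDegree_leadingCoeff_laguerre hp1).1
  apply sum_add_card_le_of_interleaved
  · rw [Finset.disjoint_filter]
    exact fun x _ h h' => h.1 h'
  · intro x hx
    have : curvMult (tiltDeriv b p) x ≠ 0 := fun h => hx (by simp [h])
    exact hU1 x ((curvMult_ne_zero_iff h1).1 this).2
  · intro x hx
    have hx := (Finset.mem_filter.1 hx).2
    rw [if_pos hx.2.2.2, curvMult_of_ne hx.2.1]
    exact rootMultiplicity_laguerre_le_add_one h1 hx.1
  · intro x hx y hy hxy hcons
    -- Without a separating extra zero of φ', all of [x, y] lies in one component as soon as it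
    -- meets one. So a zero of Q outside the components cannot be next to a zero of φ, two zeros of
    -- φ are excluded by Rolle, and two zeros of Q enclose a zero of Q₁ that is again outside the
    -- components.
    by_contra! hno
    have hB : ∀ z ∈ Ioo x y, (tiltDeriv b p).eval z = 0 → p.eval z = 0 := by
      intro z hz hz0
      by_contra hpz
      exact (hno z hz).1 (mem_extraRoots.2 ⟨hUp1 z hz0, hz0, hpz⟩)
    have hend : ∀ z, z ∈ ({x ∈ U | p.eval x ≠ 0 ∧ (tiltDeriv b p).eval x ≠ 0 ∧
        (laguerre p).eval x = 0 ∧ ∀ a, p.eval a = 0 → x ∉ critComponent b p a} ∪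
        {x ∈ U | p.eval x = 0}) → (tiltDeriv b p).eval z = 0 → p.eval z = 0 := by
      intro z hz hz0
      rw [Finset.mem_union, Finset.mem_filter, Finset.mem_filter] at hz
      rcases hz with hz | hz
      · exact absurd hz0 hz.2.2.1
      · exact hz.2
    have hB' : ∀ z ∈ Icc x y, (tiltDeriv b p).eval z = 0 → p.eval z = 0 := by
      intro z hz
      rcases hz.1.eq_or_lt with rfl | h1
      · exact hend _ hx
      rcases hz.2.eq_or_lt with rfl | h2
      · exact hend _ hy
      exact hB z ⟨h1, h2⟩
    rw [Finset.mem_union, Finset.mem_filter, Finset.mem_filter] at hx hy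
    rcases hx with hx | hx <;> rcases hy with hy | hy
    · have hpz : ∀ z ∈ Ioo x y, p.eval z ≠ 0 := by
        intro z hz h
        refine hcons z ?_ hz
        rw [Finset.mem_union, Finset.mem_filter, Finset.mem_filter]
        exact Or.inr ⟨hUp z h, h⟩
      have hne : ∀ z ∈ Icc x y, (tiltDeriv b p).eval z ≠ 0 := by
        intro z hz h
        rcases hz.1.eq_or_lt with rfl | h1
        · exact hx.2.2.1 h
        rcases hz.2.eq_or_lt with rfl | h2
        · exact hy.2.2.1 h
        exact hpz z ⟨h1, h2⟩ (hB z ⟨h1, h2⟩ h)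
      obtain ⟨z, hz, hz0⟩ := exists_laguerre_tiltDeriv_eq_zero hxy hpz hne hx.2.2.2.1 hy.2.2.2.1
      have hzI := Ioo_subset_Icc_self hz
      have := (hno z hz).2
      rw [if_pos] at this
      · exact (curvMult_ne_zero_iff h1).2 ⟨hne z hzI, hz0⟩ this
      · intro a ha hza
        refine hx.2.2.2.2 a ha (critComponent_extend hza fun w hw => ?_)
        rw [uIcc_of_ge hz.1.le] at hw
        exact hB' w ⟨hw.1, hw.2.trans hz.2.le⟩
    · refine hx.2.2.2.2 y hy.2 (critComponent_extend (self_mem_critComponent hy.2) ?_)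
      rw [uIcc_of_ge hxy.le]
      exact hB'
    · refine hy.2.2.2.2 x hx.2 (critComponent_extend (self_mem_critComponent hx.2) ?_)
      rw [uIcc_of_le hxy.le]
      exact hB'
    · obtain ⟨z, hz, hz0, hpz⟩ := exists_extra_tiltDeriv_eq_zero b hp0 hxy hx.2 hy.2
      exact hpz (hB z hz hz0)

open Classical in
theorem sum_curvMult_add_card_le {b : ℝ} (hb : b ≠ 0) {p : ℝ[X]} (hp : 0 < p.natDegree)
    {U : Finset ℝ} (hUp : ∀ x, p.eval x = 0 → x ∈ U)
    (hUp1 : ∀ x, (tiltDeriv b p).eval x = 0 → x ∈ U)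
    (hU : ∀ x, (laguerre p).eval x = 0 → x ∈ U)
    (hU1 : ∀ x, (laguerre (tiltDeriv b p)).eval x = 0 → x ∈ U)
    (hA : ∀ a, p.eval a = 0 → (∀ x ∈ critComponent b p a, x < a → curvMult p x = 0) ∨
      ∀ x ∈ critComponent b p a, a < x → curvMult p x = 0) :
    ∑ x ∈ U, curvMult p x + {x ∈ U | p.eval x = 0}.card ≤
      ∑ x ∈ extraRoots b p U, (tiltDeriv b p).rootMultiplicity x + 1 +
        ∑ x ∈ U, curvMult (tiltDeriv b p) x := by
  have hp0 := ne_zero_of_natDegree_gt hp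
  have hp1 : 0 < (tiltDeriv b p).natDegree := by rwa [(natDegree_leadingCoeff_tiltDeriv hb p).1]
  have hp10 := ne_zero_of_natDegree_gt hp1
  have key := sum_curvMult_outside_add_card_le hb hp hUp hUp1 hU1
  set A := {x ∈ U | p.eval x = 0} with hAdef
  -- A common point of two components would put a' in the component of a, whose only zero of φ is a.
  have hdisj : (A : Set ℝ).PairwiseDisjoint fun a => {x ∈ U | x ∈ critComponent b p a} := by
    intro a ha a' ha' hne
    have ha0 := (Finset.mem_filter.1 ha).2
    have ha0' := (Finset.mem_filter.1 ha').2
    refine Finset.disjoint_filter.2 fun x _ hx hx' => ?_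
    refine (eval_ne_zero_of_mem_critComponent hp0 ha0
      (critComponent_extend hx (y := a') ?_) hne.symm).1 ha0'
    rw [uIcc_comm]
    exact hx'
  have hsplit : ∀ h : ℝ → ℕ, ∑ x ∈ U, h x =
      ∑ x ∈ U, (if ∀ a, p.eval a = 0 → x ∉ critComponent b p a then h x else 0) +
      ∑ a ∈ A, ∑ x ∈ U with x ∈ critComponent b p a, h x := by
    intro h
    rw [← Finset.sum_biUnion hdisj, ← Finset.sum_filter,
      ← Finset.sum_filter_add_sum_filter_not U
        (fun x => ∀ a, p.eval a = 0 → x ∉ critComponent b p a)]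
    congr 1
    apply Finset.sum_congr _ fun _ _ => rfl
    ext x
    simp only [Finset.mem_filter, Finset.mem_biUnion, hAdef]
    push Not
    constructor
    · rintro ⟨hx, a, ha, hxa⟩
      exact ⟨a, ⟨hUp a ha, ha⟩, hx, hxa⟩
    · rintro ⟨a, ⟨-, ha⟩, hx, hxa⟩
      exact ⟨hx, a, ha, hxa⟩
  have hle : ∑ a ∈ A, ∑ x ∈ U with x ∈ critComponent b p a, curvMult p x ≤
      ∑ a ∈ A, ∑ x ∈ U with x ∈ critComponent b p a, curvMult (tiltDeriv b p) x := by
    refine Finset.sum_le_sum fun a ha => ?_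
    have ha0 := (Finset.mem_filter.1 ha).2
    exact sum_curvMult_critComponent_le hb hp hU hU1 ha0 (hA a ha0)
  -- An extra zero of φ' lies in no component, and its order for Q is one less than for φ'; adding
  -- the number of such points makes up the difference.
  have hout : ∑ x ∈ U, (if ∀ a, p.eval a = 0 → x ∉ critComponent b p a then curvMult p x else 0)
      + (extraRoots b p U).card =
      ∑ x ∈ U with p.eval x ≠ 0 ∧ (tiltDeriv b p).eval x ≠ 0 ∧ (laguerre p).eval x = 0 ∧
        ∀ a, p.eval a = 0 → x ∉ critComponent b p a, (laguerre p).rootMultiplicity x +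
      ∑ x ∈ extraRoots b p U, (tiltDeriv b p).rootMultiplicity x := by
    rw [Finset.card_eq_sum_ones, extraRoots, Finset.sum_filter, Finset.sum_filter,
      Finset.sum_filter, ← Finset.sum_add_distrib, ← Finset.sum_add_distrib]
    refine Finset.sum_congr rfl fun x _ => ?_
    by_cases hx : p.eval x = 0
    · simp [hx, curvMult_of_root hx]
    rw [curvMult_of_ne hx]
    by_cases hx1 : (tiltDeriv b p).eval x = 0
    · have hc : ∀ a, p.eval a = 0 → x ∉ critComponent b p a :=
        fun a _ h => hx (h x right_mem_uIcc hx1)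
      simp only [if_pos hc, hx1, hx, ne_eq, not_true_eq_false, not_false_eq_true, and_true,
        false_and, and_false, if_true, if_false, zero_add]
      exact rootMultiplicity_laguerre_of_tiltDeriv_root hp10 hx hx1
    · by_cases hl : (laguerre p).eval x = 0
      · simp [hx, hx1, hl]
      · simp [rootMultiplicity_eq_zero hl, hx1]
  have e0 := hsplit (curvMult p)
  have e1 := hsplit (curvMult (tiltDeriv b p))
  omega

/-! ### From polynomials to meromorphic orders -/

theorem analyticAt_eval (P : ℝ[X]) (x : ℝ) : AnalyticAt ℝ (fun y => P.eval y) x := by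
  simpa using (analyticAt_id (𝕜 := ℝ) (z := x)).aeval_polynomial P

theorem meromorphicOrderAt_eval {P : ℝ[X]} (hP : P ≠ 0) (x : ℝ) :
    meromorphicOrderAt (fun y => P.eval y) x = ((P.rootMultiplicity x : ℤ) : WithTop ℤ) := by
  have hm : MeromorphicAt (fun y => P.eval y) x := (analyticAt_eval P x).meromorphicAt
  rw [meromorphicOrderAt_eq_int_iff hm]
  obtain ⟨q, h, hq⟩ := exists_eq_pow_rootMultiplicity_mul_and_not_dvd P hP x
  refine ⟨fun y => q.eval y, analyticAt_eval q x, fun h0 => hq (dvd_iff_isRoot.2 h0), ?_⟩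
  refine Eventually.of_forall fun z => ?_
  conv_lhs => rw [h]
  simp

theorem eventually_eval_ne_zero {P : ℝ[X]} (hP : P ≠ 0) (x : ℝ) :
    ∀ᶠ y in 𝓝[≠] x, P.eval y ≠ 0 := by
  have h : {y | P.eval y = 0}.Finite := by
    refine P.roots.toFinset.finite_toSet.subset fun y hy => ?_
    simpa [hP] using hy
  have h3 : ({y | P.eval y = 0} \ {x})ᶜ ∈ 𝓝 x :=
    (h.subset sdiff_subset).isClosed.isOpen_compl.mem_nhds (by simp)
  filter_upwards [nhdsWithin_le_nhds h3, self_mem_nhdsWithin] with y hy hyx h0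
  exact hy ⟨h0, hyx⟩

section expPoly

variable {b : ℝ} {p : ℝ[X]} {φ : ℝ → ℝ}

theorem deriv_expPoly (hφ : ∀ x, φ x = Real.exp (b * x) * p.eval x) (x : ℝ) :
    deriv φ x = Real.exp (b * x) * (tiltDeriv b p).eval x := by
  rw [funext hφ]
  exact (hasDerivAt_exp_mul_eval b p x).deriv

theorem expPoly_eq_zero_iff (hφ : ∀ x, φ x = Real.exp (b * x) * p.eval x) (x : ℝ) :
    φ x = 0 ↔ p.eval x = 0 := by
  rw [hφ]; simp

theorem zeroMult_expPoly (hφ : ∀ x, φ x = Real.exp (b * x) * p.eval x) (hp : p ≠ 0) (x : ℝ) :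
    zeroMult φ x = p.rootMultiplicity x := by
  have h : meromorphicOrderAt φ x = ((p.rootMultiplicity x : ℤ) : WithTop ℤ) := by
    rw [← meromorphicOrderAt_eval hp, show φ = (fun x => Real.exp (b * x)) * fun x => p.eval x from
      funext hφ]
    exact meromorphicOrderAt_mul_of_ne_zero (by fun_prop) (Real.exp_ne_zero _)
  rw [zeroMult, h]
  simp

theorem meromorphicOrderAt_assocQ_expPoly (hφ : ∀ x, φ x = Real.exp (b * x) * p.eval x)
    (hp : 0 < p.natDegree) (x : ℝ) :
    meromorphicOrderAt (assocQ φ) x =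
      (((laguerre p).rootMultiplicity x - 2 * p.rootMultiplicity x : ℤ) : WithTop ℤ) := by
  have hp0 := ne_zero_of_natDegree_gt hp
  have h0 := (natDegree_leadingCoeff_laguerre hp).1
  have hlog : logDeriv φ = fun y => (tiltDeriv b p).eval y / p.eval y := by
    funext y
    rw [logDeriv_apply, deriv_expPoly hφ, hφ, mul_div_mul_left _ _ (Real.exp_ne_zero _)]
  have hev : assocQ φ =ᶠ[𝓝[≠] x] (fun y => (laguerre p).eval y) / fun y => (p ^ 2).eval y := by
    filter_upwards [eventually_eval_ne_zero hp0 x] with y hy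
    rw [assocQ, hlog, (hasDerivAt_tiltDeriv_div b hy).deriv, Pi.div_apply, eval_pow]
  rw [meromorphicOrderAt_congr hev, meromorphicOrderAt_div
    (analyticAt_eval (laguerre p) x).meromorphicAt (analyticAt_eval (p ^ 2) x).meromorphicAt,
    meromorphicOrderAt_eval h0, meromorphicOrderAt_eval (pow_ne_zero 2 hp0), sq,
    rootMultiplicity_mul (mul_ne_zero hp0 hp0), ← two_mul]
  norm_cast

/-- At a zero of p the order of Q is -2, which `toNat` turns into 0. -/
theorem zeroMult_assocQ_expPoly (hφ : ∀ x, φ x = Real.exp (b * x) * p.eval x)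
    (hp : 0 < p.natDegree) (x : ℝ) : zeroMult (assocQ φ) x = curvMult p x := by
  rw [zeroMult, meromorphicOrderAt_assocQ_expPoly hφ hp, WithTop.untop₀_coe]
  by_cases h : p.eval x = 0
  · have := rootMultiplicity_laguerre_of_root (ne_zero_of_natDegree_gt hp) h
    rw [curvMult_of_root h]
    omega
  · rw [curvMult_of_ne h, rootMultiplicity_eq_zero h]
    simp

theorem mem_realZeros_assocQ_expPoly (hφ : ∀ x, φ x = Real.exp (b * x) * p.eval x)
    (hp : 0 < p.natDegree) {x : ℝ} : x ∈ realZeros (assocQ φ) ↔ curvMult p x ≠ 0 := by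
  rw [← zeroMult_assocQ_expPoly hφ hp, zeroMult, realZeros, mem_ofPred_eq,
    meromorphicOrderAt_assocQ_expPoly hφ hp, WithTop.untop₀_coe, WithTop.coe_pos]
  omega

theorem finite_realZeros_assocQ_expPoly (hφ : ∀ x, φ x = Real.exp (b * x) * p.eval x)
    (hp : 0 < p.natDegree) : (realZeros (assocQ φ)).Finite := by
  have h0 := (natDegree_leadingCoeff_laguerre hp).1
  refine (laguerre p).roots.toFinset.finite_toSet.subset fun x hx => ?_
  rw [mem_realZeros_assocQ_expPoly hφ hp, curvMult_ne_zero_iff h0] at hx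
  simpa [h0] using hx.2

end expPoly

/-! ### Counting the extra zeros of φ' -/

open Classical in
theorem numZeros_eq_sum {U : Finset ℝ} {f : ℝ → ℝ} {m : ℝ → ℕ} (h : ∀ x, zeroMult f x = m x)
    (hU : ∀ x, m x ≠ 0 → x ∈ U) (Y : Set ℝ) : numZeros Y f = ∑ x ∈ U with x ∈ Y, m x := by
  rw [numZeros, funext h]
  apply finsum_mem_eq_sum_of_inter_support_eq
  ext x
  simp only [mem_inter_iff, Function.mem_support, Finset.coe_filter, mem_ofPred_eq]
  exact ⟨fun hx => ⟨⟨hU x hx.2, hx.1⟩, hx.2⟩, fun hx => ⟨hx.1.2, hx.2⟩⟩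

open Classical in
/-- The pairs of consecutive elements of a finite set. -/
noncomputable def consecutivePairs (A : Finset ℝ) : Finset (ℝ × ℝ) :=
  {ab ∈ A ×ˢ A | ab.1 < ab.2 ∧ ∀ x ∈ A, x ∉ Ioo ab.1 ab.2}

theorem mem_consecutivePairs {A : Finset ℝ} {ab : ℝ × ℝ} : ab ∈ consecutivePairs A ↔
    (ab.1 ∈ A ∧ ab.2 ∈ A) ∧ ab.1 < ab.2 ∧ ∀ x ∈ A, x ∉ Ioo ab.1 ab.2 := by
  simp [consecutivePairs]

/-- A pair is determined by its right end, which can be any element but the smallest. -/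
theorem card_consecutivePairs {A : Finset ℝ} (hA : A.Nonempty) :
    (consecutivePairs A).card + 1 = A.card := by
  have himg : (consecutivePairs A).image Prod.snd = A.erase (A.min' hA) := by
    ext y
    rw [Finset.mem_image, Finset.mem_erase]
    constructor
    · rintro ⟨ab, hab, rfl⟩
      rw [mem_consecutivePairs] at hab
      exact ⟨((A.min'_le _ hab.1.1).trans_lt hab.2.1).ne', hab.1.2⟩
    · rintro ⟨hne, hy⟩
      obtain ⟨x, hx, hxy, hmax⟩ := Finset.exists_next_left (s := A) (x := y)
        ⟨_, A.min'_mem hA, lt_of_le_of_ne (A.min'_le y hy) hne.symm⟩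
      exact ⟨(x, y), mem_consecutivePairs.2
        ⟨⟨hx, hy⟩, hxy, fun z hz hz' => (hmax z hz hz'.2).not_gt hz'.1⟩, rfl⟩
  have hinj : Set.InjOn Prod.snd (consecutivePairs A : Set (ℝ × ℝ)) := by
    rintro ⟨x, y⟩ h ⟨x', y'⟩ h' (rfl : y = y')
    rw [Finset.mem_coe, mem_consecutivePairs] at h h'
    have : x = x' := by
      rcases lt_trichotomy x x' with hlt | heq | hlt
      · exact absurd ⟨hlt, h'.2.1⟩ (h.2.2 x' h'.1.1)
      · exact heq
      · exact absurd ⟨hlt, h.2.1⟩ (h'.2.2 x h.1.1)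
    rw [this]
  rw [← Finset.card_image_of_injOn hinj, himg, Finset.card_erase_add_one (A.min'_mem hA)]

open Classical in
theorem sum_consecutivePairs_add_sum_outer (U A : Finset ℝ) (h : ℝ → ℕ) :
    ∑ ab ∈ consecutivePairs A, ∑ x ∈ U with x ∈ Ioo ab.1 ab.2, h x +
      ∑ x ∈ U with (∀ a ∈ A, a < x) ∨ (∀ a ∈ A, x < a), h x = ∑ x ∈ U with x ∉ A, h x := by
  have hdisj : (consecutivePairs A : Set (ℝ × ℝ)).PairwiseDisjoint
      fun ab => {x ∈ U | x ∈ Ioo ab.1 ab.2} := by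
    rintro ⟨a, c⟩ hac ⟨a', c'⟩ hac' hne
    rw [Finset.mem_coe, mem_consecutivePairs] at hac hac'
    refine Finset.disjoint_filter.2 fun x _ hx hx' => hne ?_
    have h1 := hac.2.2 a' hac'.1.1
    have h2 := hac.2.2 c' hac'.1.2
    have h3 := hac'.2.2 a hac.1.1
    have h4 := hac'.2.2 c hac.1.2
    simp only [mem_Ioo, not_and, not_lt] at *
    ext
    · by_contra hcon
      rcases lt_or_gt_of_ne hcon with h | h
      · linarith [h1 h]
      · linarith [h3 h]
    · by_contra hcon
      rcases lt_or_gt_of_ne hcon with h | h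
      · linarith [h4 (by linarith)]
      · linarith [h2 (by linarith)]
  rw [← Finset.sum_biUnion hdisj, ← Finset.sum_union]
  · apply Finset.sum_congr _ fun _ _ => rfl
    ext x
    simp only [Finset.mem_union, Finset.mem_biUnion, Finset.mem_filter, mem_consecutivePairs]
    constructor
    · rintro (⟨ab, hab, hx, hxI⟩ | ⟨hx, hxo⟩)
      · exact ⟨hx, fun hxA => hab.2.2 x hxA hxI⟩
      · exact ⟨hx, fun hxA => hxo.elim (fun h => lt_irrefl _ (h x hxA))
          fun h => lt_irrefl _ (h x hxA)⟩
    · rintro ⟨hx, hxA⟩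
      by_cases hr : ∃ c ∈ A, x < c
      · by_cases hl : ∃ a ∈ A, a < x
        · left
          obtain ⟨c, hc, hxc, hmin⟩ := Finset.exists_next_right hr
          obtain ⟨a, ha, hax, hmax⟩ := Finset.exists_next_left hl
          refine ⟨(a, c), ⟨⟨ha, hc⟩, hax.trans hxc, fun z hz hzI => ?_⟩, hx, hax, hxc⟩
          rcases lt_trichotomy z x with h | rfl | h
          · exact (hmax z hz h).not_gt hzI.1
          · exact hxA hz
          · exact (hmin z hz h).not_gt hzI.2
        · push Not at hl
          exact Or.inr ⟨hx, Or.inr fun a ha => lt_of_le_of_ne (hl a ha) (by rintro rfl; exact hxA ha)⟩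
      · push Not at hr
        exact Or.inr ⟨hx, Or.inl fun a ha => lt_of_le_of_ne (hr a ha) (by rintro rfl; exact hxA ha)⟩
  · rw [Finset.disjoint_left]
    intro x hx hx'
    rw [Finset.mem_biUnion] at hx
    obtain ⟨ab, hab, hx⟩ := hx
    have hx := (Finset.mem_filter.1 hx).2
    rw [mem_consecutivePairs] at hab
    rcases (Finset.mem_filter.1 hx').2 with h | h
    · exact (h _ hab.1.2).not_gt hx.2
    · exact (h _ hab.1.1).not_gt hx.1

-- The N zeros of φ bound N - 1 gaps if N > 0, each costing one zero of φ'; if N = 0 there is no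
-- gap, which explains the final summand.
open Classical in
theorem numExtraZeros_expPoly {b : ℝ} (hb : b ≠ 0) {p : ℝ[X]} (hp : 0 < p.natDegree)
    {φ : ℝ → ℝ} (hφ : ∀ x, φ x = Real.exp (b * x) * p.eval x) {U : Finset ℝ}
    (hUp : ∀ x, p.eval x = 0 → x ∈ U) (hUp1 : ∀ x, (tiltDeriv b p).eval x = 0 → x ∈ U) :
    numExtraZeros φ + {x ∈ U | p.eval x = 0}.card =
      ∑ x ∈ extraRoots b p U, (tiltDeriv b p).rootMultiplicity x +
        if {x ∈ U | p.eval x = 0}.Nonempty then 1 else 0 := by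
  have hp0 := ne_zero_of_natDegree_gt hp
  have hp1 : tiltDeriv b p ≠ 0 :=
    ne_zero_of_natDegree_gt (by rwa [(natDegree_leadingCoeff_tiltDeriv hb p).1])
  set A := {x ∈ U | p.eval x = 0} with hAdef
  have hA : ∀ x, x ∈ A ↔ φ x = 0 := fun x => by
    rw [expPoly_eq_zero_iff hφ, hAdef, Finset.mem_filter]
    exact ⟨fun h => h.2, fun h => ⟨hUp x h, h⟩⟩
  have hnum : ∀ Y, numZeros Y (deriv φ) =
      ∑ x ∈ U with x ∈ Y, (tiltDeriv b p).rootMultiplicity x := by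
    apply numZeros_eq_sum (zeroMult_expPoly (deriv_expPoly hφ) hp1)
    intro x hx
    exact hUp1 x ((rootMultiplicity_pos hp1).1 (Nat.pos_of_ne_zero hx))
  have hout : ∑ x ∈ U with x ∉ A, (tiltDeriv b p).rootMultiplicity x =
      ∑ x ∈ extraRoots b p U, (tiltDeriv b p).rootMultiplicity x := by
    rw [extraRoots, Finset.sum_filter, Finset.sum_filter]
    refine Finset.sum_congr rfl fun x _ => ?_
    simp only [hA, expPoly_eq_zero_iff hφ]
    by_cases h1 : (tiltDeriv b p).eval x = 0
    · simp [h1]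
    · simp [rootMultiplicity_eq_zero h1]
  have hcons : {ab : ℝ × ℝ | ConsecutiveZeros φ ab.1 ab.2} = ↑(consecutivePairs A) := by
    ext ab
    simp only [mem_ofPred_eq, Finset.mem_coe, mem_consecutivePairs, ConsecutiveZeros, hA]
    constructor
    · rintro ⟨h1, h2, h3, h4⟩
      exact ⟨⟨h2, h3⟩, h1, fun x hx hx' => h4 x hx' hx⟩
    · rintro ⟨⟨h2, h3⟩, h1, h4⟩
      exact ⟨h1, h2, h3, fun x hx hx' => h4 x hx' hx⟩
  have hinner : ∀ a c, numZeros (Ioo a c) (deriv φ) =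
      ∑ x ∈ U with x ∈ Ioo a c, (tiltDeriv b p).rootMultiplicity x := by
    intro a c
    rw [hnum]
    exact Finset.sum_congr (by ext; simp) fun _ _ => rfl
  have houter : numZeros (outerSet φ) (deriv φ) = ∑ x ∈ U with
      (∀ a ∈ A, a < x) ∨ (∀ a ∈ A, x < a), (tiltDeriv b p).rootMultiplicity x := by
    rw [hnum]
    refine Finset.sum_congr (Finset.ext fun x => ?_) fun _ _ => rfl
    rw [Finset.mem_filter, Finset.mem_filter, outerSet, mem_ofPred_eq]
    simp only [hA]
  rw [numExtraZeros, hcons, finsum_mem_coe_finset, houter]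
  simp only [hinner]
  split_ifs with hne
  · rw [← hout, ← sum_consecutivePairs_add_sum_outer U A, ← card_consecutivePairs hne]
    have : ∑ ab ∈ consecutivePairs A,
        (∑ x ∈ U with x ∈ Ioo ab.1 ab.2, (tiltDeriv b p).rootMultiplicity x - 1) +
        (consecutivePairs A).card = ∑ ab ∈ consecutivePairs A,
        ∑ x ∈ U with x ∈ Ioo ab.1 ab.2, (tiltDeriv b p).rootMultiplicity x := by
      rw [Finset.card_eq_sum_ones, ← Finset.sum_add_distrib]
      -- The truncated subtraction is exact: Rolle gives a zero of φ' in each gap.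
      refine Finset.sum_congr rfl fun ab hab => Nat.sub_add_cancel ?_
      rw [mem_consecutivePairs, hA, hA, expPoly_eq_zero_iff hφ, expPoly_eq_zero_iff hφ] at hab
      obtain ⟨z, hz, hz0⟩ := exists_tiltDeriv_eq_zero b hab.2.1 hab.1.1 hab.1.2
      refine le_trans ((rootMultiplicity_pos hp1).2 hz0 : 1 ≤ _) ?_
      exact Finset.single_le_sum (f := fun x => (tiltDeriv b p).rootMultiplicity x)
        (fun _ _ => Nat.zero_le _)
        (Finset.mem_filter.2 ⟨hUp1 z hz0, hz⟩)
    omega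
  · have hA0 : A = ∅ := Finset.not_nonempty_iff_eq_empty.1 hne
    rw [← hout, hA0]
    simp [consecutivePairs]

/-! ### Conclusion -/

theorem curvMult_eq_zero_of_propertyA {b : ℝ} {p : ℝ[X]} (hp : 0 < p.natDegree)
    {φ : ℝ → ℝ} (hφ : ∀ x, φ x = Real.exp (b * x) * p.eval x) (hA : PropertyA φ) (a : ℝ)
    (ha : p.eval a = 0) : (∀ x ∈ critComponent b p a, x < a → curvMult p x = 0) ∨
      ∀ x ∈ critComponent b p a, a < x → curvMult p x = 0 := by
  have hp0 := ne_zero_of_natDegree_gt hp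
  have hd : ∀ y ∈ critComponent b p a, y ≠ a → deriv φ y ≠ 0 := fun y hy hya => by
    rw [deriv_expPoly hφ]
    exact mul_ne_zero (Real.exp_ne_zero _) (eval_ne_zero_of_mem_critComponent hp0 ha hy hya).2
  have hI : (critComponent b p a).OrdConnected := ordConnected_critComponent
  refine (hA a ((expPoly_eq_zero_iff hφ a).2 ha)).imp (fun h x hx hxa => ?_) fun h x hx hxa => ?_
  · by_contra hne
    refine disjoint_left.1 h ⟨hxa, fun y hy => ?_⟩ ((mem_realZeros_assocQ_expPoly hφ hp).2 hne)
    exact hd y (hI.out hx (self_mem_critComponent ha) ⟨hy.1, hy.2.le⟩) hy.2.ne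
  · by_contra hne
    refine disjoint_left.1 h ⟨hxa, fun y hy => ?_⟩ ((mem_realZeros_assocQ_expPoly hφ hp).2 hne)
    exact hd y (hI.out (self_mem_critComponent ha) hx ⟨hy.1.le, hy.2⟩) hy.1.ne'

theorem mainTheorem6 (p : ℝ[X]) (hp : 0 < p.natDegree) (b : ℝ) (hb : b ≠ 0)
    (φ : ℝ → ℝ) (hφ : ∀ x, φ x = Real.exp (b * x) * p.eval x) (hA : PropertyA φ) :
    (realZeros (assocQ φ)).Finite ∧
    (realZeros (assocQ (deriv φ))).Finite ∧
    2 * (numExtraZeros φ / 2) ≤ numZeros univ (assocQ φ) ∧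
    numZeros univ (assocQ φ) ≤
      2 * (numExtraZeros φ / 2) + numZeros univ (assocQ (deriv φ)) := by
  classical
  have hφ' := deriv_expPoly hφ
  have hp1 : 0 < (tiltDeriv b p).natDegree := by rwa [(natDegree_leadingCoeff_tiltDeriv hb p).1]
  have hp0 := ne_zero_of_natDegree_gt hp
  have hp10 := ne_zero_of_natDegree_gt hp1
  have h0 := (natDegree_leadingCoeff_laguerre hp).1
  have h1 := (natDegree_leadingCoeff_laguerre hp1).1
  refine ⟨finite_realZeros_assocQ_expPoly hφ hp, finite_realZeros_assocQ_expPoly hφ' hp1, ?_⟩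
  set U := p.roots.toFinset ∪ (tiltDeriv b p).roots.toFinset ∪
    (laguerre p).roots.toFinset ∪ (laguerre (tiltDeriv b p)).roots.toFinset with hUdef
  have hUp : ∀ x, p.eval x = 0 → x ∈ U := fun x hx => by simp [hUdef, hp0, hx]
  have hUp1 : ∀ x, (tiltDeriv b p).eval x = 0 → x ∈ U := fun x hx => by simp [hUdef, hp10, hx]
  have hU : ∀ x, (laguerre p).eval x = 0 → x ∈ U := fun x hx => by simp [hUdef, h0, hx]
  have hU1 : ∀ x, (laguerre (tiltDeriv b p)).eval x = 0 → x ∈ U :=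
    fun x hx => by simp [hUdef, h1, hx]
  have eQ : numZeros univ (assocQ φ) = ∑ x ∈ U, curvMult p x := by
    rw [numZeros_eq_sum (zeroMult_assocQ_expPoly hφ hp)
      fun x hx => hU x ((curvMult_ne_zero_iff h0).1 hx).2]
    simp
  have eQ1 : numZeros univ (assocQ (deriv φ)) = ∑ x ∈ U, curvMult (tiltDeriv b p) x := by
    rw [numZeros_eq_sum (zeroMult_assocQ_expPoly hφ' hp1)
      fun x hx => hU1 x ((curvMult_ne_zero_iff h1).1 hx).2]
    simp
  obtain ⟨i, hi⟩ := even_sum_curvMult hp hU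
  obtain ⟨j, hj⟩ := even_sum_curvMult hp1 hU1
  obtain ⟨k, hk⟩ := even_card_roots_add_sum_extraRoots hb hp hUp hUp1
  have hlow := sum_extraRoots_le (b := b) hp hUp hU
  have hupp := sum_curvMult_add_card_le hb hp hUp hUp1 hU hU1
    (curvMult_eq_zero_of_propertyA hp hφ hA)
  have hE := numExtraZeros_expPoly hb hp hφ hUp hUp1
  rw [eQ, eQ1]
  -- If φ has a real zero, E = S - N + 1 is odd; if not, E = S is even. Either way 2[E/2] = S - N,
  -- and the parities `hi`, `hj`, `hk` absorb the + 1 in `hlow` and `hupp`.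
  by_cases hne : {x ∈ U | p.eval x = 0}.Nonempty
  · rw [if_pos hne] at hE
    omega
  · rw [if_neg hne] at hE
    have hcard : {x ∈ U | p.eval x = 0}.card = 0 :=
      Finset.card_eq_zero.2 (Finset.not_nonempty_iff_eq_empty.1 hne)
    omega
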